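/- Let $n\ge 0$ be an integer. Let $\Lambda_n^+=\{(d_0,d_1,\dots,d_n,d_\infty)\in\mathbb{N}_0^{n+2} : d_0=d_\infty\}$, $\delta_0=(1,1,\dots,1,1)$, let $\mathrm{e}_k\in\Lambda_n^+$ be the vector with a single $1$ at the $k$-th place ($1\le k\le n$) and zeros elsewhere, and $\mathrm{f}_k=\delta_0-\mathrm{e}_k$. Let $\mathscr{P}_n$ be the $\mathbb{Z}\times\Lambda_n^+$-graded associative unital $\mathbb{Q}$-algebra with generators $g_{2i}$, $h_{2i+2}$, $e_{k,2i+1}$, $f_{k,2i+1}$ ($i\ge 0$, $1\le k\le n$) of degrees $$\deg g_{2i}=(2i,\delta_0),\quad \deg h_{2i+2}=(2i+2,\delta_0),\quad \deg e_{k,2i+1}=(2i+1,\mathrm{e}_k),\quad \deg f_{k,2i+1}=(2i+1,\mathrm{f}_k),$$ subject to the following relations for all $i,j\ge0$ and all $k,l$, where $[a,b]=ab-ba$ and $\{a,b\}=ab+ba$: \begin{align*} &\{e_{k,2i+1},e_{k,2j+1}\}=0,\qquad \{f_{k,2i+1},f_{k,2j+1}\}=0,\qquad \{e_{k,2i+1},f_{k,2j+1}\}=h_{2(i+j)+2},\\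 &[e_{k,2i+1},e_{l,2j+1}]=[f_{k,2i+1},f_{l,2j+1}]=[e_{k,2i+1},f_{l,2j+1}]=0\quad (k\ne l),\\ &[h_{2i+2},e_{k,2j+1}]=[h_{2i+2},f_{k,2j+1}]=[h_{2i+2},h_{2j+2}]=0,\\ &[g_{2i},e_{k,2j+1}]=\sum_{r=0}^{j-1}h_{2(i+j-r)}\,e_{k,2r+1},\\ &[g_{2i},f_{k,2j+1}]=-[g_{2j},f_{k,2i+1}],\qquad [g_{2i},f_{k,2j+1}]=\sum_{r=0}^{j-i-1}f_{k,2(j-1-r)+1}\,h_{2(r+i)+2}\quad(i\le j),\\ &[g_{2i},h_{2j+2}]=-[g_{2j},h_{2i+2}],\qquad [g_{2i},h_{2j+2}]=\sum_{r=0}^{j-i-1}h_{2(j-1-r)+2}\,h_{2(r+i)+2}\quad(i\le j),\\ &[g_{2i},g_{2j}]=2\sum_{r=0}^{j-i-1}g_{2(j-1-r)}\,h_{2(r+i)+2}\quad(i\le j). \end{align*} Then the ordered monomials $$g_{a_1}g_{a_2}\cdots\, h_{b_1}h_{b_2}\cdots\, e_{1,c_{1,1}}e_{1,c_{1,2}}\cdots\,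 e_{n,c_{n,1}}e_{n,c_{n,2}}\cdots\, f_{1,d_{1,1}}f_{1,d_{1,2}}\cdots\, f_{n,d_{n,1}}f_{n,d_{n,2}}\cdots$$ with finite (possibly empty) index sequences satisfying $a_1\ge a_2\ge\cdots$, $b_1\ge b_2\ge\cdots$, $c_{k,1}>c_{k,2}>\cdots$ and $d_{k,1}>d_{k,2}>\cdots$ for all $k$ (indexed without repetition by these sequences) form a $\mathbb{Q}$-basis of $\mathscr{P}_n$. Moreover, there is an isomorphism of $\mathbb{Z}\times\Lambda_n^+$-graded $\mathbb{Q}$-vector spaces $$\mathscr{P}_n\cong \operatorname{Sym}(V\otimes_{\mathbb{Q}}\mathbb{Q}[z]),\qquad \deg z=(2,0),$$ where $V$ is the graded super vector space over $\mathbb{Q}$ which is the direct sum of one-dimensional spaces: for each $k=1,\dots,n$, an odd one in degree $(1,\mathrm{e}_k)$ and an odd one in degree $(1,\mathrm{f}_k)$, and, in addition, two even ones in degrees $(0,\delta_0)$ and $(2,\delta_0)$. The parity is the first (cohomological) degree modulo $2$, and $\operatorname{Sym}(W)$ denotes the free supercommutative algebra on $W$, i.e. the tensor algebra of $W$ modulo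 the relations $vw=(-1)^{|v||w|}wv$ for homogeneous $v,w\in W$, with the induced grading. (In particular the gradings by total degree on $\mathscr{P}_n$ and on $\operatorname{Sym}(V\otimes_{\mathbb{Q}}\mathbb{Q}[z])$ are well-defined algebra gradings.) -/

import Mathlib

open scoped TensorProduct Polynomial

noncomputable section

namespace PAlg

/-! ### The grading monoid -/

/-- The vertices `0`, `1, …, n`, `∞` of the quiver with `n` arms, each having one inner vertex
(the inner vertices are numbered by `Fin n`). -/
inductive Vertex (n : ℕ) : Type
  | zero : Vertex n
  | mid (k : Fin n) : Vertex n
  | infty : Vertex n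

/-- The monoid of dimension vectors `d` with `d 0 = d ∞`. -/
def Lam (n : ℕ) : AddSubmonoid (Vertex n → ℕ) where
  carrier := {d | d Vertex.zero = d Vertex.infty}
  zero_mem' := rfl
  add_mem' := by
    intro a b ha hb
    exact congrArg₂ (· + ·) ha hb

/-- Bidegrees: cohomological degree and dimension vector. -/
abbrev Bideg (n : ℕ) : Type := ℤ × Lam n

instance (n : ℕ) : DecidableEq (Bideg n) := Classical.decEq _

/-- The dimension vector `(1, 1, …, 1, 1)`. -/
def delta (n : ℕ) : Lam n := ⟨fun _ => 1, rfl⟩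

/-- The dimension vector with a `1` at the `k`-th inner vertex and `0` elsewhere. -/
def dimE {n : ℕ} (k : Fin n) : Lam n :=
  ⟨fun v => match v with
    | Vertex.zero => 0
    | Vertex.mid l => if l = k then 1 else 0
    | Vertex.infty => 0, rfl⟩

/-- The dimension vector with a `0` at the `k`-th inner vertex and `1` elsewhere. -/
def dimF {n : ℕ} (k : Fin n) : Lam n :=
  ⟨fun v => match v with
    | Vertex.zero => 1
    | Vertex.mid l => if l = k then 0 else 1
    | Vertex.infty => 1, rfl⟩

/-! ### The algebra, by generators and relations -/

/-- The generators: `g i`, `h i`, `e k i`, `f k i` stand for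
`g_{2i}`, `h_{2i+2}`, `e_{k,2i+1}`, `f_{k,2i+1}`. -/
inductive Gen (n : ℕ) : Type
  | g (i : ℕ) : Gen n
  | h (i : ℕ) : Gen n
  | e (k : Fin n) (i : ℕ) : Gen n
  | f (k : Fin n) (i : ℕ) : Gen n

/-- The bidegrees of the generators. -/
def Gen.deg {n : ℕ} : Gen n → Bideg n
  | .g i => (2 * (i : ℤ), delta n)
  | .h i => (2 * (i : ℤ) + 2, delta n)
  | .e k i => (2 * (i : ℤ) + 1, dimE k)
  | .f k i => (2 * (i : ℤ) + 1, dimF k)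

section Free

variable (n : ℕ)

/-- The free algebra on the generators. -/
abbrev Free : Type := FreeAlgebra ℚ (Gen n)

/-- The generator `g_{2i}` of the free algebra. -/
def G (i : ℕ) : Free n := FreeAlgebra.ι ℚ (Gen.g i)

/-- The generator `h_{2i+2}` of the free algebra. -/
def H (i : ℕ) : Free n := FreeAlgebra.ι ℚ (Gen.h i)

variable {n}

/-- The generator `e_{k,2i+1}` of the free algebra. -/
def E (k : Fin n) (i : ℕ) : Free n := FreeAlgebra.ι ℚ (Gen.e k i)

/-- The generator `f_{k,2i+1}` of the free algebra. -/
def F (k : Fin n) (i : ℕ) : Free n := FreeAlgebra.ι ℚ (Gen.f k i)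

end Free

/-- The commutator. -/
def comm {A : Type*} [Ring A] (a b : A) : A := a * b - b * a

/-- The anticommutator. -/
def anticomm {A : Type*} [Ring A] (a b : A) : A := a * b + b * a

/-- The defining relations. -/
inductive Rel (n : ℕ) : Free n → Free n → Prop
  | ee (k : Fin n) (i j : ℕ) : Rel n (anticomm (E k i) (E k j)) 0
  | ff (k : Fin n) (i j : ℕ) : Rel n (anticomm (F k i) (F k j)) 0
  | ef (k : Fin n) (i j : ℕ) : Rel n (anticomm (E k i) (F k j)) (H n (i + j))
  | ee_ne (k l : Fin n) (hkl : k ≠ l) (i j : ℕ) : Rel n (comm (E k i) (E l j)) 0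
  | ff_ne (k l : Fin n) (hkl : k ≠ l) (i j : ℕ) : Rel n (comm (F k i) (F l j)) 0
  | ef_ne (k l : Fin n) (hkl : k ≠ l) (i j : ℕ) : Rel n (comm (E k i) (F l j)) 0
  | he (k : Fin n) (i j : ℕ) : Rel n (comm (H n i) (E k j)) 0
  | hf (k : Fin n) (i j : ℕ) : Rel n (comm (H n i) (F k j)) 0
  | hh (i j : ℕ) : Rel n (comm (H n i) (H n j)) 0
  | ge (k : Fin n) (i j : ℕ) :
      Rel n (comm (G n i) (E k j)) (∑ r ∈ Finset.range j, H n (i + (j - 1 - r)) * E k r)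
  | gf_anti (k : Fin n) (i j : ℕ) : Rel n (comm (G n i) (F k j)) (-comm (G n j) (F k i))
  | gf (k : Fin n) (i j : ℕ) (hij : i ≤ j) :
      Rel n (comm (G n i) (F k j))
        (∑ r ∈ Finset.range (j - i), F k (j - 1 - r) * H n (r + i))
  | gh_anti (i j : ℕ) : Rel n (comm (G n i) (H n j)) (-comm (G n j) (H n i))
  | gh (i j : ℕ) (hij : i ≤ j) :
      Rel n (comm (G n i) (H n j))
        (∑ r ∈ Finset.range (j - i), H n (j - 1 - r) * H n (r + i))
  | gg (i j : ℕ) (hij : i ≤ j) :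
      Rel n (comm (G n i) (G n j))
        (2 * ∑ r ∈ Finset.range (j - i), G n (j - 1 - r) * H n (r + i))

/-- The algebra `𝒫_n`. -/
abbrev P (n : ℕ) : Type := RingQuot (Rel n)

/-- The image of a generator in `𝒫_n`. -/
def gen {n : ℕ} (x : Gen n) : P n := RingQuot.mkAlgHom ℚ (Rel n) (FreeAlgebra.ι ℚ x)

/-- The homogeneous component of `𝒫_n` of a given bidegree: the span of the products of
generators of that total bidegree. -/
def P.piece (n : ℕ) (γ : Bideg n) : Submodule ℚ (P n) :=
  Submodule.span ℚ {x | ∃ w : List (Gen n), (w.map Gen.deg).sum = γ ∧ x = (w.map gen).prod}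

/-! ### The ordered monomials -/

/-- Index data of an ordered monomial: weakly decreasing finite sequences for the `g`'s and the
`h`'s, strictly decreasing ones for each family `e_k` and `f_k`. -/
structure PBWIndex (n : ℕ) : Type where
  a : {l : List ℕ // l.Pairwise (· ≥ ·)}
  b : {l : List ℕ // l.Pairwise (· ≥ ·)}
  c : Fin n → {l : List ℕ // l.Pairwise (· > ·)}
  d : Fin n → {l : List ℕ // l.Pairwise (· > ·)}

/-- The ordered monomial: first the `g`'s, then the `h`'s, the `e_1`'s, …, the `e_n`'s, the
`f_1`'s, …, the `f_n`'s. -/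
def pbwMonomial {n : ℕ} (s : PBWIndex n) : P n :=
  (s.a.1.map fun i => gen (Gen.g i)).prod *
  (s.b.1.map fun i => gen (Gen.h i)).prod *
  (List.ofFn fun k => ((s.c k).1.map fun i => gen (Gen.e k i)).prod).prod *
  (List.ofFn fun k => ((s.d k).1.map fun i => gen (Gen.f k i)).prod).prod

/-! ### Symmetric algebras of bigraded super vector spaces -/

section SuperSym

variable {Λ : Type} [AddCommMonoid Λ] {W : Type} [AddCommGroup W] [Module ℚ W]

/-- The relations `v w = (-1)^{|v||w|} w v` for homogeneous `v`, `w`, where the parity of a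
homogeneous vector is its cohomological degree modulo `2`. -/
inductive SuperSymRel (𝒲 : ℤ × Λ → Submodule ℚ W) : TensorAlgebra ℚ W → TensorAlgebra ℚ W → Prop
  | swap (α β : ℤ × Λ) (v w : W) (hv : v ∈ 𝒲 α) (hw : w ∈ 𝒲 β) :
      SuperSymRel 𝒲 (TensorAlgebra.ι ℚ v * TensorAlgebra.ι ℚ w)
        (Int.negOnePow (α.1 * β.1) • (TensorAlgebra.ι ℚ w * TensorAlgebra.ι ℚ v))

/-- The free supercommutative algebra `Sym W` on the super vector space `W`. -/
abbrev SuperSym (𝒲 : ℤ × Λ → Submodule ℚ W) : Type := RingQuot (SuperSymRel 𝒲)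

/-- The canonical map `W → Sym W`. -/
def SuperSym.ι (𝒲 : ℤ × Λ → Submodule ℚ W) : W →ₗ[ℚ] SuperSym 𝒲 :=
  (RingQuot.mkAlgHom ℚ (SuperSymRel 𝒲)).toLinearMap ∘ₗ TensorAlgebra.ι ℚ

/-- The homogeneous component of `Sym W` of a given bidegree: the span of the products of
homogeneous elements of `W` of that total bidegree. -/
def SuperSym.piece (𝒲 : ℤ × Λ → Submodule ℚ W) (γ : ℤ × Λ) : Submodule ℚ (SuperSym 𝒲) :=
  Submodule.span ℚ {x | ∃ l : List ((ℤ × Λ) × W), (∀ p ∈ l, p.2 ∈ 𝒲 p.1) ∧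
    (l.map Prod.fst).sum = γ ∧ x = (l.map fun p => SuperSym.ι 𝒲 p.2).prod}

/-- The total grading on the tensor product of two bigraded vector spaces. -/
def tensorPiece {U : Type} [AddCommGroup U] [Module ℚ U]
    (𝒲 : ℤ × Λ → Submodule ℚ W) (𝒰 : ℤ × Λ → Submodule ℚ U) (γ : ℤ × Λ) :
    Submodule ℚ (W ⊗[ℚ] U) :=
  Submodule.span ℚ {x | ∃ (α β : ℤ × Λ) (w : W) (u : U), w ∈ 𝒲 α ∧ u ∈ 𝒰 β ∧ α + β = γ ∧
    x = w ⊗ₜ[ℚ] u}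

/-- The grading on `ℚ[z]` with `deg z = (2, 0)`. -/
def polyPiece (γ : ℤ × Λ) : Submodule ℚ ℚ[X] :=
  Submodule.span ℚ {p | ∃ i : ℕ, (2 * (i : ℤ), (0 : Λ)) = γ ∧ p = Polynomial.X ^ i}

end SuperSym

/-! ### The super vector space `V` -/

/-- The one-dimensional summands of `V`: one in dimension degree `e_k` and one in dimension degree
`f_k` for each `k`, and two in dimension degree `δ₀`. -/
inductive Summand (n : ℕ) : Type
  | e (k : Fin n) : Summand n
  | f (k : Fin n) : Summand n
  | delta0 : Summand n
  | delta2 : Summand n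

/-- The bidegrees of the summands of `V`; the summands `e k`, `f k` are odd, the others even. -/
def Summand.deg {n : ℕ} : Summand n → Bideg n
  | .e k => (1, dimE k)
  | .f k => (1, dimF k)
  | .delta0 => (0, delta n)
  | .delta2 => (2, delta n)

/-- The vector space `V`, the direct sum of its one-dimensional summands. -/
abbrev V (n : ℕ) : Type := Summand n →₀ ℚ

/-- The bigrading of `V`. -/
def V.piece (n : ℕ) (γ : Bideg n) : Submodule ℚ (V n) :=
  Submodule.span ℚ {v | ∃ s : Summand n, s.deg = γ ∧ v = Finsupp.single s 1}

/-- The bigrading of `V ⊗ ℚ[z]`. -/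
abbrev VZ.piece (n : ℕ) : Bideg n → Submodule ℚ (V n ⊗[ℚ] ℚ[X]) :=
  tensorPiece (V.piece n) polyPiece

end PAlg

end

/-!
The proof rests on two facts about `P n`, each of which is also needed, in a simpler form, for the
free supercommutative algebra.

*Ordered monomials span.* Give `g` the weight `2` and `h`, `e`, `f` the weight `1`. Each relation
says that two generators commute up to a sign and up to words of lower weight and of the same degree
(`gen_mul_gen_sub_mem`). Hence a word agrees, up to a scalar and words of lower weight, with each of
its permutations, and it is itself a combination of words of lower weight if it contains a repeated
`e` or `f`. Induction on the weight (`wordSpan_le_of_perm`) shows that a word is a combination of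
ordered monomials of the same degree.

*Ordered monomials are linearly independent.* `P n` acts on an algebra `OscAlg n` with generators
`h_j` and `e_{k,j}`, where `e_{k,i}` and `e_{k,j}` anticommute and all other pairs commute: `h` and
`e` act by multiplication, `f_{k,j}` by a twisted derivation with `e_{k,i} ↦ h_{i+j}`, and `g_i` by
the derivation which prescribes its commutators with `h` and `e`. To verify a relation between these
operators, one moves the difference of its two sides past the multiplications by generators. The
only relation which is not a rearrangement of sums is the one for `[g_i, g_j]`, applied to `h_l`:
it amounts to the Jacobi identity for the Poisson bracket `{h_i, h_j} = [g_i, h_j]`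
(`osum_hBracket_cyclic`), which follows from an identity between divided differences.

For independence the action is deformed: `h_L` acts by multiplication by `h_L + 1`, for a large `L`.
With respect to the filtration by word length, the operators of `g_i` and `f_{k,j}` then have as
leading terms the partial derivatives with respect to `h_{2L+1-i}` and `e_{k,L-j}`. If `L` is large
with respect to the indices in a given linear relation, these variables are distinct from each other
and from the variables by which the `h` and `e` in the relation act. The leading terms of the ordered
monomials are thus normally ordered monomials in independent creation and annihilation operators,
for which dual functionals can be written down (`testForm_lead_ne_zero_iff`).

The free supercommutative algebra maps to a colour-commutative algebra, where partial derivatives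
separate the monomials (`ColorAlg.linearIndependent_word`). So both algebras have bases of words
indexed by the same set and of the same degrees, and degree-preserving spanning makes both graded.
-/

noncomputable section

namespace PAlg

/-! ### Words in the generators of an algebra with quasi-commutation relations -/

section Words

variable {A I Γ S : Type*} [Ring A] [Algebra ℚ A] [AddCommMonoid Γ]

/-- The span of the products of generators `x i` of total degree `γ`. -/
def wordSpan (x : I → A) (deg : I → Γ) (γ : Γ) : Submodule ℚ A :=
  Submodule.span ℚ {a | ∃ l : List I, (l.map deg).sum = γ ∧ a = (l.map x).prod}

/-- The span of the products of generators of total degree `γ` and of weight less than `d`. -/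
def lowSpan (x : I → A) (deg : I → Γ) (w : I → ℕ) (d : ℕ) (γ : Γ) : Submodule ℚ A :=
  Submodule.span ℚ
    {a | ∃ l : List I, (l.map w).sum < d ∧ (l.map deg).sum = γ ∧ a = (l.map x).prod}

variable {x : I → A} {deg : I → Γ} {w : I → ℕ}

theorem prod_mem_wordSpan (l : List I) : (l.map x).prod ∈ wordSpan x deg (l.map deg).sum :=
  Submodule.subset_span ⟨l, rfl, rfl⟩

theorem prod_mem_lowSpan {l : List I} {d : ℕ} {γ : Γ} (hd : (l.map w).sum < d)
    (hγ : (l.map deg).sum = γ) : (l.map x).prod ∈ lowSpan x deg w d γ :=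
  Submodule.subset_span ⟨l, hd, hγ, rfl⟩

theorem mul_mem_wordSpan {γ γ' : Γ} {a b : A} (ha : a ∈ wordSpan x deg γ)
    (hb : b ∈ wordSpan x deg γ') : a * b ∈ wordSpan x deg (γ + γ') := by
  have h := Submodule.mul_mem_mul ha hb
  rw [wordSpan, wordSpan, Submodule.span_mul_span] at h
  refine Submodule.span_mono ?_ h
  rintro _ ⟨_, ⟨l, rfl, rfl⟩, _, ⟨l', rfl, rfl⟩, rfl⟩
  exact ⟨l ++ l', by simp, by simp⟩

theorem mul_mem_lowSpan {d : ℕ} {γ : Γ} {a : A} (ha : a ∈ lowSpan x deg w d γ) (u v : List I) :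
    (u.map x).prod * a * (v.map x).prod ∈
      lowSpan x deg w ((u.map w).sum + d + (v.map w).sum)
        ((u.map deg).sum + γ + (v.map deg).sum) := by
  induction ha using Submodule.span_induction with
  | mem a h =>
    obtain ⟨l, hd, rfl, rfl⟩ := h
    refine Submodule.subset_span ⟨u ++ l ++ v, ?_, by simp [add_assoc], by simp [mul_assoc]⟩
    simp only [List.map_append, List.sum_append]
    omega
  | zero => simp
  | add a b _ _ ha hb => rw [mul_add, add_mul]; exact add_mem ha hb
  | smul c a _ ha =>
    rw [mul_smul_comm, smul_mul_assoc]; exact Submodule.smul_mem _ c ha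

/-- The commutator of two elements with respect to a scalar. -/
def colorComm (c : ℚ) (a b : A) : A := a * b - c • (b * a)

theorem colorComm_one (a b : A) : colorComm 1 a b = a * b - b * a := by
  rw [colorComm, one_smul]

theorem colorComm_neg_one (a b : A) : colorComm (-1) a b = a * b + b * a := by
  rw [colorComm, neg_smul, one_smul, sub_neg_eq_add]

theorem colorComm_swap {c : ℚ} (hc : c * c = 1) (a b : A) :
    colorComm c b a = -c • colorComm c a b := by
  rw [colorComm, colorComm, smul_sub, smul_smul, neg_mul, hc, neg_smul, neg_smul, one_smul]
  abel

variable {σ : I → I → ℚ}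

/-- If the generators commute up to scalars and terms of lower weight, so do all words. -/
theorem exists_sub_smul_mem_lowSpan_of_perm
    (rel : ∀ i j, colorComm (σ i j) (x i) (x j) ∈ lowSpan x deg w (w i + w j) (deg i + deg j))
    {l l' : List I} (h : l.Perm l') :
    ∃ c : ℚ, (l.map x).prod - c • (l'.map x).prod ∈
      lowSpan x deg w (l.map w).sum (l.map deg).sum := by
  induction h with
  | nil => exact ⟨1, by simp⟩
  | @cons i l l' _ ih =>
    obtain ⟨c, hc⟩ := ih
    refine ⟨c, ?_⟩
    have := mul_mem_lowSpan hc [i] []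
    simpa [mul_sub] using this
  | swap i j l =>
    refine ⟨σ j i, ?_⟩
    have := mul_mem_lowSpan (rel j i) [] l
    simpa [colorComm, sub_mul, mul_assoc, add_assoc] using this
  | @trans l₁ l₂ l₃ h₁ h₂ ih₁ ih₂ =>
    obtain ⟨c, hc⟩ := ih₁
    obtain ⟨d, hd⟩ := ih₂
    refine ⟨c * d, ?_⟩
    rw [← (h₁.map w).sum_eq, ← (h₁.map deg).sum_eq] at hd
    have := add_mem hc (Submodule.smul_mem _ c hd)
    rwa [smul_sub, smul_smul, sub_add_sub_cancel] at this

/-- Each word is a combination of the normal words `L s` of the same degree, provided that the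
generators commute up to signs and terms of lower weight, and that every word can be permuted
into a normal one or into one with a repeated odd generator. -/
theorem wordSpan_le_of_perm
    (rel : ∀ i j, colorComm (σ i j) (x i) (x j) ∈ lowSpan x deg w (w i + w j) (deg i + deg j))
    (L : S → List I)
    (hL : ∀ l : List I, (∃ s, l.Perm (L s)) ∨ ∃ i l', σ i i = -1 ∧ l.Perm (i :: i :: l'))
    (γ : Γ) :
    wordSpan x deg γ ≤
      Submodule.span ℚ {a | ∃ s, ((L s).map deg).sum = γ ∧ a = ((L s).map x).prod} := by
  have key : ∀ d : ℕ, ∀ l : List I, (l.map w).sum < d → (l.map x).prod ∈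
      Submodule.span ℚ {a | ∃ s, ((L s).map deg).sum = (l.map deg).sum ∧
        a = ((L s).map x).prod} := by
    intro d
    induction d with
    | zero => intro l hl; omega
    | succ d ih =>
      intro l hl
      have low : lowSpan x deg w (l.map w).sum (l.map deg).sum ≤
          Submodule.span ℚ {a | ∃ s, ((L s).map deg).sum = (l.map deg).sum ∧
            a = ((L s).map x).prod} := by
        refine Submodule.span_le.2 ?_
        rintro _ ⟨l', hl', hdeg, rfl⟩
        rw [← hdeg]
        exact ih l' (by omega)
      have hperm : ∀ l' : List I, l.Perm l' → (l'.map x).prod ∈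
          Submodule.span ℚ {a | ∃ s, ((L s).map deg).sum = (l.map deg).sum ∧
            a = ((L s).map x).prod} → (l.map x).prod ∈
          Submodule.span ℚ {a | ∃ s, ((L s).map deg).sum = (l.map deg).sum ∧
            a = ((L s).map x).prod} := by
        intro l' h hmem
        obtain ⟨c, hc⟩ := exists_sub_smul_mem_lowSpan_of_perm rel h
        have := add_mem (low hc) (Submodule.smul_mem _ c hmem)
        rwa [sub_add_cancel] at this
      rcases hL l with ⟨s, hs⟩ | ⟨i, l', hi, h⟩
      · exact hperm _ hs (Submodule.subset_span ⟨s, ((hs.map deg).sum_eq).symm, rfl⟩)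
      · refine hperm _ h (low ?_)
        -- an odd generator has square of lower weight, as `2` is invertible
        have h1 := rel i i
        rw [hi, colorComm_neg_one, ← two_smul ℚ (x i * x i)] at h1
        have h2 := Submodule.smul_mem _ (2⁻¹ : ℚ) h1
        rw [smul_smul, inv_mul_cancel₀ two_ne_zero, one_smul] at h2
        have h3 := mul_mem_lowSpan h2 [] l'
        rw [(h.map w).sum_eq, (h.map deg).sum_eq]
        simpa [mul_assoc, add_assoc] using h3
  refine Submodule.span_le.2 ?_
  rintro _ ⟨l, rfl, rfl⟩
  exact key _ l (Nat.lt_succ_self _)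

theorem wordSpan_eq_span_basis {L : S → List I} (b : Module.Basis S ℚ A)
    (hb : ∀ s, b s = ((L s).map x).prod)
    (hspan : ∀ γ, wordSpan x deg γ ≤
      Submodule.span ℚ {a | ∃ s, ((L s).map deg).sum = γ ∧ a = ((L s).map x).prod}) (γ : Γ) :
    wordSpan x deg γ = Submodule.span ℚ (b '' {s | ((L s).map deg).sum = γ}) := by
  refine le_antisymm ((hspan γ).trans (Submodule.span_mono ?_)) (Submodule.span_le.2 ?_)
  · rintro _ ⟨s, hs, rfl⟩
    exact ⟨s, hs, hb s⟩
  · rintro _ ⟨s, rfl, rfl⟩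
    rw [hb]
    exact prod_mem_wordSpan _

/-- An algebra with a basis of words is graded by total degree, if each word is a combination of
basis words of the same degree. -/
theorem nonempty_gradedAlgebra_wordSpan [DecidableEq Γ] {L : S → List I}
    (b : Module.Basis S ℚ A) (hb : ∀ s, b s = ((L s).map x).prod)
    (hspan : ∀ γ, wordSpan x deg γ ≤
      Submodule.span ℚ {a | ∃ s, ((L s).map deg).sum = γ ∧ a = ((L s).map x).prod}) :
    Nonempty (GradedAlgebra (wordSpan x deg)) := by
  have hmem : ∀ s, b s ∈ wordSpan x deg ((L s).map deg).sum := fun s => by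
    rw [hb]; exact prod_mem_wordSpan _
  let D : A →ₗ[ℚ] DirectSum Γ fun γ => wordSpan x deg γ :=
    b.constr ℚ fun s => DirectSum.lof ℚ Γ (fun γ => wordSpan x deg γ) _ ⟨b s, hmem s⟩
  have hD : ∀ s, D (b s) = DirectSum.lof ℚ Γ (fun γ => wordSpan x deg γ) _ ⟨b s, hmem s⟩ :=
    fun s => b.constr_basis ℚ _ s
  have h₁ : DirectSum.coeLinearMap (wordSpan x deg) ∘ₗ D = LinearMap.id := by
    refine b.ext fun s => ?_
    rw [LinearMap.comp_apply, hD, DirectSum.coeLinearMap_lof]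
    rfl
  have h₂ : D ∘ₗ DirectSum.coeLinearMap (wordSpan x deg) = LinearMap.id := by
    refine DirectSum.linearMap_ext ℚ fun γ => LinearMap.ext fun a => ?_
    obtain ⟨a, ha⟩ := a
    simp only [LinearMap.comp_apply, LinearMap.id_apply, DirectSum.coeLinearMap_lof]
    have ha' := ha
    rw [wordSpan_eq_span_basis b hb hspan] at ha'
    induction ha' using Submodule.span_induction with
    | mem a h =>
      obtain ⟨s, rfl, rfl⟩ := h
      exact hD s
    | zero => rw [map_zero]; exact (map_zero (DirectSum.lof ℚ Γ _ _)).symm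
    | add a c h h' iha ihc =>
      rw [← wordSpan_eq_span_basis b hb hspan] at h h'
      rw [map_add, iha h, ihc h', ← map_add]; rfl
    | smul r a h iha =>
      rw [← wordSpan_eq_span_basis b hb hspan] at h
      rw [map_smul, iha h, ← map_smul]; rfl
  exact ⟨{ toDecomposition := DirectSum.Decomposition.ofLinearMap _ D h₁ h₂
           one_mem := Submodule.subset_span ⟨[], rfl, rfl⟩
           mul_mem := fun _ _ _ _ ha hc => mul_mem_wordSpan ha hc }⟩

end Words

/-! ### Colour-commutative algebras -/

section Color

variable {I : Type*}

/-- The relations `x_i x_j = σ_{ij} x_j x_i`. -/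
inductive ColorRel (σ : I → I → ℚ) : FreeAlgebra ℚ I → FreeAlgebra ℚ I → Prop
  | swap (i j : I) : ColorRel σ (FreeAlgebra.ι ℚ i * FreeAlgebra.ι ℚ j)
      (σ i j • (FreeAlgebra.ι ℚ j * FreeAlgebra.ι ℚ i))

/-- The algebra generated by elements `x_i` which commute up to the scalars `σ_{ij}`. -/
def ColorAlg (σ : I → I → ℚ) : Type _ := RingQuot (ColorRel σ)

/-- The conditions on a matrix of signs under which the algebra `ColorAlg σ` has the expected size:
a generator either anticommutes with itself (it is *odd*), or commutes with all generators. -/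
structure IsColor (σ : I → I → ℚ) : Prop where
  symm : ∀ i j, σ i j = σ j i
  sq : ∀ i j, σ i j * σ i j = 1
  odd_or_central : ∀ i, σ i i = -1 ∨ ∀ j, σ i j = 1

/-- A word is reduced if no odd generator occurs twice in it. -/
def Reduced [DecidableEq I] (σ : I → I → ℚ) (l : List I) : Prop :=
  ∀ i, σ i i = -1 → l.count i ≤ 1

theorem Reduced.of_cons [DecidableEq I] {σ : I → I → ℚ} {i : I} {l : List I}
    (h : Reduced σ (i :: l)) : Reduced σ l :=
  fun j hj => List.count_le_count_cons.trans (h j hj)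

theorem Reduced.diff [DecidableEq I] {σ : I → I → ℚ} {l : List I} (h : Reduced σ l)
    (a : List I) : Reduced σ (l.diff a) := fun j hj => by
  have := h j hj
  rw [List.count_diff]; omega

namespace ColorAlg

variable {σ : I → I → ℚ}

instance : Ring (ColorAlg σ) := inferInstanceAs (Ring (RingQuot (ColorRel σ)))

instance : Algebra ℚ (ColorAlg σ) := inferInstanceAs (Algebra ℚ (RingQuot (ColorRel σ)))

variable (σ) in
/-- The quotient map from the free algebra. -/
def mk : FreeAlgebra ℚ I →ₐ[ℚ] ColorAlg σ := RingQuot.mkAlgHom ℚ (ColorRel σ)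

theorem mk_surjective : Function.Surjective (mk σ) := RingQuot.mkAlgHom_surjective ℚ _

variable (σ) in
/-- The generators. -/
def X (i : I) : ColorAlg σ := mk σ (FreeAlgebra.ι ℚ i)

theorem X_mul_X (i j : I) : X σ i * X σ j = σ i j • (X σ j * X σ i) := by
  have := RingQuot.mkAlgHom_rel ℚ (ColorRel.swap (σ := σ) i j)
  rw [map_mul, map_smul, map_mul] at this
  exact this

section Lift

variable {B : Type*} [Ring B] [Algebra ℚ B] (f : I → B)
  (hf : ∀ i j, f i * f j = σ i j • (f j * f i))

/-- The universal property. -/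
def lift : ColorAlg σ →ₐ[ℚ] B :=
  RingQuot.liftAlgHom ℚ ⟨FreeAlgebra.lift ℚ f, by
    rintro _ _ ⟨i, j⟩
    simpa using hf i j⟩

@[simp] theorem lift_X (i : I) : lift f hf (X σ i) = f i :=
  (RingQuot.liftAlgHom_mkAlgHom_apply _ _ _ _).trans (FreeAlgebra.lift_ι_apply f i)

end Lift

@[elab_as_elim]
theorem induction {p : ColorAlg σ → Prop} (one : p 1) (add : ∀ a b, p a → p b → p (a + b))
    (smul : ∀ (c : ℚ) a, p a → p (c • a)) (mul : ∀ i a, p a → p (X σ i * a))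
    (a : ColorAlg σ) : p a := by
  have key : ∀ u : FreeAlgebra ℚ I, ∀ a, p a → p (mk σ u * a) := by
    intro u
    induction u using FreeAlgebra.induction with
    | grade0 r =>
      intro a ha
      rw [AlgHom.commutes, ← Algebra.smul_def]
      exact smul r a ha
    | grade1 i => exact mul i
    | mul u v hu hv => intro a ha; rw [map_mul, mul_assoc]; exact hu _ (hv _ ha)
    | add u v hu hv => intro a ha; rw [map_add, add_mul]; exact add _ _ (hu _ ha) (hv _ ha)
  obtain ⟨u, rfl⟩ := mk_surjective a
  have := key u 1 one
  rwa [mul_one] at this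

/-- A linear map which kills `1` and commutes up to scalars with the generators vanishes. -/
theorem linearMap_eq_zero {Z : Module.End ℚ (ColorAlg σ)} (h₁ : Z 1 = 0)
    (h : ∀ i, ∃ c : ℚ, ∀ a, Z (X σ i * a) = c • (X σ i * Z a)) (a : ColorAlg σ) : Z a = 0 := by
  induction a using induction with
  | one => exact h₁
  | add a b ha hb => rw [map_add, ha, hb, add_zero]
  | smul c a ha => rw [map_smul, ha, smul_zero]
  | mul i a ha =>
    obtain ⟨c, hc⟩ := h i
    rw [hc, ha, mul_zero, smul_zero]

variable (σ) in
/-- The monomial of a word. -/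
def word (l : List I) : ColorAlg σ := (l.map (X σ)).prod

@[simp] theorem word_nil : word σ [] = 1 := rfl

@[simp] theorem word_cons (i : I) (l : List I) : word σ (i :: l) = X σ i * word σ l := by
  simp [word]

theorem word_append (l l' : List I) : word σ (l ++ l') = word σ l * word σ l' := by
  simp [word]

variable (σ) in
/-- The augmentation, which kills all generators. -/
def aug : ColorAlg σ →ₐ[ℚ] ℚ := lift (fun _ => 0) (by simp)

@[simp] theorem aug_X (i : I) : aug σ (X σ i) = 0 := lift_X _ _ _

theorem aug_word {l : List I} (hl : l ≠ []) : aug σ (word σ l) = 0 := by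
  cases l with
  | nil => exact absurd rfl hl
  | cons i l => simp

/-! ### The filtration by word length -/

variable (σ) in
/-- The span of the words of length at least `p`. -/
def fil (p : ℤ) : Submodule ℚ (ColorAlg σ) :=
  Submodule.span ℚ {a | ∃ l : List I, p ≤ l.length ∧ a = word σ l}

theorem word_mem_fil {p : ℤ} {l : List I} (h : p ≤ l.length) : word σ l ∈ fil σ p :=
  Submodule.subset_span ⟨l, h, rfl⟩

theorem X_mem_fil (i : I) : X σ i ∈ fil σ 1 := by
  simpa using word_mem_fil (σ := σ) (p := 1) (l := [i]) (by simp)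

theorem fil_anti {p q : ℤ} (h : p ≤ q) : fil σ q ≤ fil σ p :=
  Submodule.span_mono fun _ ⟨l, hl, ha⟩ => ⟨l, h.trans hl, ha⟩

theorem mul_mem_fil {p q : ℤ} {a b : ColorAlg σ} (ha : a ∈ fil σ p) (hb : b ∈ fil σ q) :
    a * b ∈ fil σ (p + q) := by
  have h := Submodule.mul_mem_mul ha hb
  rw [fil, fil, Submodule.span_mul_span] at h
  refine Submodule.span_mono ?_ h
  rintro _ ⟨_, ⟨l, hl, rfl⟩, _, ⟨l', hl', rfl⟩, rfl⟩
  exact ⟨l ++ l', by push_cast [List.length_append]; omega, (word_append l l').symm⟩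

theorem sub_aug_mem_fil (a : ColorAlg σ) : a - algebraMap ℚ _ (aug σ a) ∈ fil σ 1 := by
  have hmem : ∀ b : ColorAlg σ, b ∈ fil σ 0 := by
    intro b
    induction b using induction with
    | one => exact word_mem_fil (l := []) (by simp)
    | add a b ha hb => exact add_mem ha hb
    | smul c a ha => exact Submodule.smul_mem _ c ha
    | mul i a ha => exact fil_anti (by norm_num) (mul_mem_fil (X_mem_fil i) ha)
  induction a using induction with
  | one => simp
  | add a b ha hb => rw [map_add, map_add, add_sub_add_comm]; exact add_mem ha hb
  | smul c a ha =>
    rw [map_smul, smul_eq_mul, map_mul, ← Algebra.smul_def, ← smul_sub]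
    exact Submodule.smul_mem _ c ha
  | mul i a ha => simpa using mul_mem_fil (X_mem_fil i) (hmem a)

theorem mem_fil_one_of_aug {a : ColorAlg σ} (h : aug σ a = 0) : a ∈ fil σ 1 := by
  simpa [h] using sub_aug_mem_fil a

theorem aug_of_mem_fil {a : ColorAlg σ} (h : a ∈ fil σ 1) : aug σ a = 0 := by
  induction h using Submodule.span_induction with
  | mem a h =>
    obtain ⟨l, hl, rfl⟩ := h
    exact aug_word (by rintro rfl; simp at hl)
  | zero => simp
  | add a b _ _ ha hb => rw [map_add, ha, hb, add_zero]
  | smul c a _ ha => rw [map_smul, ha, smul_zero]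

/-! ### Twisted derivations of colour-commutative algebras -/

/-- A twisted derivation with prescribed values on the generators, obtained from the algebra
homomorphism `a ↦ !![τ a, D a; 0, a]`. -/
theorem exists_twisted_derivation (hσ : IsColor σ) (τ : ColorAlg σ →ₐ[ℚ] ColorAlg σ)
    (d : I → ColorAlg σ) (h : ∀ i j, d i * X σ j = σ i j • (τ (X σ j) * d i)) :
    ∃ D : Module.End ℚ (ColorAlg σ), (∀ i, D (X σ i) = d i) ∧
      ∀ a b, D (a * b) = D a * b + τ a * D b := by
  let f : I → Matrix (Fin 2) (Fin 2) (ColorAlg σ) := fun i => !![τ (X σ i), d i; 0, X σ i]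
  have hf : ∀ i j, f i * f j = σ i j • (f j * f i) := by
    intro i j
    have h2 : τ (X σ i) * d j = σ i j • (d j * X σ i) := by
      rw [h j i, smul_smul, ← hσ.symm i j, hσ.sq, one_smul]
    have h3 : τ (X σ i) * τ (X σ j) = σ i j • (τ (X σ j) * τ (X σ i)) := by
      rw [← map_mul, X_mul_X, map_smul, map_mul]
    ext p q
    fin_cases p <;> fin_cases q <;>
      simp [f, Matrix.mul_apply, Fin.sum_univ_two, h3, h2, h i j, X_mul_X i j]
    rw [add_comm]
  let Φ := lift f hf
  have hΦ : ∀ i, Φ (X σ i) = f i := lift_X f hf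
  have key : ∀ a, Φ a 0 0 = τ a ∧ Φ a 1 0 = 0 ∧ Φ a 1 1 = a := by
    intro a
    induction a using induction with
    | one => simp
    | add a b ha hb => simp [ha, hb]
    | smul c a ha => simp [ha]
    | mul i a ha => simp [ha, hΦ, Matrix.mul_apply, Fin.sum_univ_two, f]
  refine ⟨{ toFun := fun a => Φ a 0 1, map_add' := ?_, map_smul' := ?_ }, ?_, ?_⟩
  · intro a b; simp
  · intro c a; simp
  · intro i; simp [hΦ, f]
  · intro a b
    simp [Matrix.mul_apply, Fin.sum_univ_two, key, add_comm]

/-- The automorphism which multiplies each generator by its sign with respect to the generator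
`x_i`. -/
def signHom (i : I) : ColorAlg σ →ₐ[ℚ] ColorAlg σ :=
  lift (fun j => σ i j • X σ j) fun j k => by
    rw [smul_mul_smul_comm, smul_mul_smul_comm, X_mul_X j k, smul_comm, mul_comm (σ i j)]

@[simp] theorem signHom_X (i j : I) : signHom i (X σ j) = σ i j • X σ j := lift_X _ _ _

theorem signHom_mem_fil (i : I) {p : ℤ} {a : ColorAlg σ} (h : a ∈ fil σ p) :
    signHom i a ∈ fil σ p := by
  induction h using Submodule.span_induction with
  | mem a h =>
    obtain ⟨l, hl, rfl⟩ := h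
    refine fil_anti hl ?_
    clear hl
    induction l with
    | nil => rw [word_nil, map_one]; exact word_mem_fil (l := []) le_rfl
    | cons j l ih =>
      rw [word_cons, map_mul, signHom_X, smul_mul_assoc]
      refine Submodule.smul_mem _ _ (fil_anti ?_ (mul_mem_fil (X_mem_fil j) ih))
      push_cast [List.length_cons]; omega
  | zero => simp
  | add a b _ _ ha hb => rw [map_add]; exact add_mem ha hb
  | smul c a _ ha => rw [map_smul]; exact Submodule.smul_mem _ c ha

/-- A twisted derivation shifts the filtration by `q` if it does so on the generators. -/
theorem twisted_derivation_mem_fil {τ : ColorAlg σ → ColorAlg σ} {D : Module.End ℚ (ColorAlg σ)}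
    (hτ : ∀ p a, a ∈ fil σ p → τ a ∈ fil σ p) (hmul : ∀ a b, D (a * b) = D a * b + τ a * D b)
    (h₁ : D 1 = 0) {q : ℤ} (hD : ∀ i, D (X σ i) ∈ fil σ (1 + q)) {p : ℤ} {a : ColorAlg σ}
    (ha : a ∈ fil σ p) : D a ∈ fil σ (p + q) := by
  induction ha using Submodule.span_induction with
  | mem a h =>
    obtain ⟨l, hl, rfl⟩ := h
    refine fil_anti (add_le_add_left hl q) ?_
    clear hl
    induction l with
    | nil => rw [word_nil, h₁]; exact zero_mem _
    | cons j l ih =>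
      rw [word_cons, hmul]
      refine add_mem (fil_anti ?_ (mul_mem_fil (hD j) (word_mem_fil le_rfl)))
        (fil_anti ?_ (mul_mem_fil (hτ _ _ (X_mem_fil j)) ih)) <;>
      · push_cast [List.length_cons]; omega
  | zero => simp
  | add a b _ _ ha hb => rw [map_add]; exact add_mem ha hb
  | smul c a _ ha => rw [map_smul]; exact Submodule.smul_mem _ c ha

variable [DecidableEq I]

theorem exists_partial (hσ : IsColor σ) (i : I) :
    ∃ D : Module.End ℚ (ColorAlg σ), (∀ j, D (X σ j) = if j = i then 1 else 0) ∧
      ∀ a b, D (a * b) = D a * b + signHom i a * D b := by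
  refine exists_twisted_derivation hσ (signHom i) _ fun j k => ?_
  split_ifs with h
  · subst h
    rw [signHom_X, one_mul, mul_one, smul_smul, hσ.sq, one_smul]
  · simp

/-- The partial derivative with respect to a generator. -/
def pd (hσ : IsColor σ) (i : I) : Module.End ℚ (ColorAlg σ) := (exists_partial hσ i).choose

theorem pd_X (hσ : IsColor σ) (i j : I) : pd hσ i (X σ j) = if j = i then 1 else 0 :=
  (exists_partial hσ i).choose_spec.1 j

theorem pd_mul (hσ : IsColor σ) (i : I) (a b : ColorAlg σ) :
    pd hσ i (a * b) = pd hσ i a * b + signHom i a * pd hσ i b :=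
  (exists_partial hσ i).choose_spec.2 a b

theorem pd_one (hσ : IsColor σ) (i : I) : pd hσ i 1 = 0 := by
  have := pd_mul hσ i 1 1
  simpa using this

theorem pd_X_mul (hσ : IsColor σ) (i j : I) (a : ColorAlg σ) :
    pd hσ i (X σ j * a) = (if j = i then a else 0) + σ i j • (X σ j * pd hσ i a) := by
  rw [pd_mul, pd_X, signHom_X, ite_mul, one_mul, zero_mul, smul_mul_assoc]

theorem X_mul_word_erase {i : I} (hi : ∀ j, σ i j = 1) {l : List I} (hl : i ∈ l) :
    X σ i * word σ (l.erase i) = word σ l := by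
  induction l with
  | nil => simp at hl
  | cons j l ih =>
    by_cases hji : j = i
    · subst hji; simp
    · have hil : i ∈ l := by simpa [Ne.symm hji] using hl
      rw [List.erase_cons_tail (by simpa using hji), word_cons, ← mul_assoc, X_mul_X, hi,
        one_smul, mul_assoc, ih hil, word_cons]

/-- Partial derivatives of reduced words. The nonvanishing of the scalar is where characteristic
zero enters: for a central generator the scalar is its multiplicity. -/
theorem exists_pd_word (hσ : IsColor σ) (i : I) {l : List I} (hl : Reduced σ l) :
    ∃ c : ℚ, pd hσ i (word σ l) = c • word σ (l.erase i) ∧ (c ≠ 0 ↔ i ∈ l) := by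
  rcases hσ.odd_or_central i with hi | hi
  · induction l with
    | nil => exact ⟨0, by simp [pd_one]⟩
    | cons j l ih =>
      obtain ⟨c, hc, hc'⟩ := ih hl.of_cons
      rw [word_cons, pd_X_mul]
      by_cases hji : j = i
      · subst hji
        have hj : j ∉ l := by
          have := hl j hi
          rw [List.count_cons_self] at this
          exact List.count_eq_zero.1 (by omega)
        have hc0 : c = 0 := by_contra fun h => hj (hc'.1 h)
        refine ⟨1, ?_, by simp⟩
        simp [hc, hc0]
      · refine ⟨σ i j * c, ?_, ?_⟩
        · rw [List.erase_cons_tail (by simpa using hji), word_cons, if_neg hji, hc, zero_add,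
            mul_smul_comm, smul_smul]
        · have h0 : σ i j ≠ 0 := fun h => by simpa [h] using hσ.sq i j
          simp [h0, ← hc', Ne.symm hji]
  · refine ⟨l.count i, ?_, by rw [Nat.cast_ne_zero, ← Nat.pos_iff_ne_zero, List.count_pos_iff]⟩
    clear hl
    induction l with
    | nil => simp [pd_one]
    | cons j l ih =>
      rw [word_cons, pd_X_mul, ih, hi, one_smul, mul_smul_comm]
      by_cases hji : j = i
      · subst hji
        rw [if_pos rfl, List.count_cons_self, List.erase_cons_head]
        by_cases hj : j ∈ l
        · rw [X_mul_word_erase hi hj]; push_cast; rw [add_smul, one_smul, add_comm]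
        · simp [List.count_eq_zero.2 hj]
      · rw [if_neg hji, zero_add, List.erase_cons_tail (by simpa using hji), word_cons,
          List.count_cons_of_ne hji]

/-- Iterated partial derivatives of reduced words. -/
theorem exists_prod_pd_word (hσ : IsColor σ) (a : List I) {l : List I} (hl : Reduced σ l) :
    ∃ c : ℚ, (a.map (pd hσ)).prod (word σ l) = c • word σ (l.diff a) ∧
      (c ≠ 0 ↔ ∀ i, a.count i ≤ l.count i) := by
  induction a with
  | nil => exact ⟨1, by simp⟩
  | cons i a ih =>
    obtain ⟨c, hc, hc'⟩ := ih
    obtain ⟨d, hd, hd'⟩ := exists_pd_word hσ i (hl.diff a)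
    refine ⟨c * d, ?_, ?_⟩
    · rw [List.map_cons, List.prod_cons, Module.End.mul_apply, hc, map_smul, hd, smul_smul,
        List.diff_cons_right]
    · rw [mul_ne_zero_iff, hc', hd', ← List.count_pos_iff, List.count_diff]
      constructor
      · rintro ⟨h1, h2⟩ j
        by_cases hj : i = j
        · subst hj; rw [List.count_cons_self]; omega
        · rw [List.count_cons_of_ne hj]; exact h1 j
      · intro h
        refine ⟨fun j => List.count_le_count_cons.trans (h j), ?_⟩
        have := h i
        rw [List.count_cons_self] at this; omega

/-- Reduced words which are not permutations of each other are linearly independent. -/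
theorem linearIndependent_word (hσ : IsColor σ) {S : Type*} (L : S → List I)
    (hL : ∀ s, Reduced σ (L s)) (hinj : ∀ s t, (L s).Perm (L t) → s = t) :
    LinearIndependent ℚ fun s => word σ (L s) := by
  rw [linearIndependent_iff']
  intro T c hc s hs
  obtain ⟨r, hr, hr'⟩ := exists_prod_pd_word hσ (L s) (hL s)
  have hz : ∀ t ∈ T, t ≠ s → aug σ (((L s).map (pd hσ)).prod (word σ (L t))) = 0 := by
    intro t _ hts
    obtain ⟨q, hq, hq'⟩ := exists_prod_pd_word hσ (L s) (hL t)
    rw [hq, map_smul]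
    by_cases hq0 : q = 0
    · rw [hq0, zero_smul]
    · have h1 := hq'.1 hq0
      rw [aug_word, smul_zero]
      intro h2
      refine hts (hinj _ _ (List.perm_iff_count.2 fun i => ?_))
      have := congrArg (List.count i) h2
      rw [List.count_diff, List.count_nil] at this
      have := h1 i
      omega
  have hdiff : (L s).diff (L s) = [] := by
    refine List.eq_nil_iff_forall_not_mem.2 fun i hi => ?_
    have := List.count_pos_iff.2 hi
    rw [List.count_diff] at this
    omega
  have h0 := congrArg (fun y => aug σ (((L s).map (pd hσ)).prod y)) hc
  simp only [map_sum, map_smul, map_zero] at h0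
  rw [Finset.sum_eq_single_of_mem s hs fun t ht hts => by rw [hz t ht hts, smul_zero], hr,
    hdiff, word_nil, map_smul, map_one, smul_eq_mul, smul_eq_mul, mul_one] at h0
  exact (mul_eq_zero.1 h0).resolve_right (hr'.2 fun _ => le_rfl)

theorem pd_mem_fil (hσ : IsColor σ) (i : I) {p : ℤ} {a : ColorAlg σ} (ha : a ∈ fil σ p) :
    pd hσ i a ∈ fil σ (p - 1) := by
  refine twisted_derivation_mem_fil (fun p a => signHom_mem_fil i) (pd_mul hσ i) (pd_one hσ i)
    (q := -1) (fun j => ?_) ha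
  rw [pd_X]
  split_ifs
  · exact word_mem_fil (l := []) (by simp)
  · exact zero_mem _

theorem prod_pd_mem_fil (hσ : IsColor σ) (l : List I) {p : ℤ} {a : ColorAlg σ}
    (ha : a ∈ fil σ p) : (l.map (pd hσ)).prod a ∈ fil σ (p - l.length) := by
  induction l with
  | nil => simpa using ha
  | cons i l ih =>
    rw [List.map_cons, List.prod_cons, Module.End.mul_apply]
    refine fil_anti (le_of_eq ?_) (pd_mem_fil hσ i ih)
    push_cast [List.length_cons]; ring

end ColorAlg

end Color

/-! ### Identities between oriented sums -/

section OrientedSum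

/-- The oriented sum of `φ` over the integers from `i` to `j - 1`: it changes sign when `i` and `j`
are exchanged, and is additive in the interval. -/
def osum {M : Type*} [AddCommGroup M] (i j : ℕ) (φ : ℕ → M) : M :=
  ∑ a ∈ Finset.range j, φ a - ∑ a ∈ Finset.range i, φ a

section AddCommGroup

variable {M N : Type*} [AddCommGroup M] [AddCommGroup N]

theorem osum_swap (i j : ℕ) (φ : ℕ → M) : osum j i φ = -osum i j φ := by simp [osum]

theorem osum_add_osum (i j k : ℕ) (φ : ℕ → M) : osum i j φ + osum j k φ = osum i k φ := by
  simp only [osum]; abel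

theorem osum_add (i j : ℕ) (φ ψ : ℕ → M) :
    osum i j (fun a => φ a + ψ a) = osum i j φ + osum i j ψ := by
  simp only [osum, Finset.sum_add_distrib]; abel

theorem osum_neg (i j : ℕ) (φ : ℕ → M) : osum i j (fun a => -φ a) = -osum i j φ := by
  simp only [osum, Finset.sum_neg_distrib]; abel

theorem osum_sub (i j : ℕ) (φ ψ : ℕ → M) :
    osum i j (fun a => φ a - ψ a) = osum i j φ - osum i j ψ := by
  simp only [osum, Finset.sum_sub_distrib]; abel

theorem map_osum (F : M →+ N) (i j : ℕ) (φ : ℕ → M) :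
    F (osum i j φ) = osum i j fun a => F (φ a) := by simp [osum]

theorem osum_sum (i j m : ℕ) (φ : ℕ → ℕ → M) :
    osum i j (fun a => ∑ q ∈ Finset.range m, φ a q) =
      ∑ q ∈ Finset.range m, osum i j fun a => φ a q := by
  simp only [osum, Finset.sum_sub_distrib]
  rw [Finset.sum_comm, Finset.sum_comm (s := Finset.range i)]

theorem osum_eq_sum {i j : ℕ} (hij : i ≤ j) (φ : ℕ → M) :
    osum i j φ = ∑ r ∈ Finset.range (j - i), φ (j - 1 - r) := by
  rw [osum, ← Finset.sum_Ico_eq_sub _ hij, Finset.sum_Ico_eq_sum_range, ← Finset.sum_range_reflect]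
  refine Finset.sum_congr rfl fun r hr => ?_
  have := Finset.mem_range.1 hr
  congr 1; omega

theorem osum_congr {i j : ℕ} {φ ψ : ℕ → M} (h : ∀ a, a < i + j → φ a = ψ a) :
    osum i j φ = osum i j ψ := by
  simp only [osum]
  congr 1 <;> refine Finset.sum_congr rfl fun a ha => h a ?_ <;>
  · have := Finset.mem_range.1 ha; omega

theorem osum_reflect (i j : ℕ) (φ : ℕ → M) :
    osum i j (fun a => φ (i + j - 1 - a)) = osum i j φ := by
  wlog hij : i ≤ j generalizing i j
  · rw [osum_swap, osum_swap j i φ, ← this j i (by omega), add_comm]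
  rw [osum_eq_sum hij, osum_eq_sum hij, ← Finset.sum_range_reflect]
  refine Finset.sum_congr rfl fun r hr => ?_
  have := Finset.mem_range.1 hr
  congr 1; omega

end AddCommGroup

theorem mul_osum {A : Type*} [Ring A] (x : A) (i j : ℕ) (φ : ℕ → A) :
    x * osum i j φ = osum i j fun a => x * φ a := by simp [osum, Finset.mul_sum, mul_sub]

theorem osum_mul {A : Type*} [Ring A] (x : A) (i j : ℕ) (φ : ℕ → A) :
    osum i j φ * x = osum i j fun a => φ a * x := by simp [osum, Finset.sum_mul, sub_mul]

section CommRing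

variable {R : Type*} [CommRing R] (h : ℕ → R)

/-- The right hand side of the relation for `[g_{2i}, h_{2j+2}]`, as a skew-symmetric function of
`i` and `j`. The subtraction in the index truncates only for `i = j = 0`, where the sum is empty. -/
def hBracket (i j : ℕ) : R := osum i j fun c => h c * h (i + j - 1 - c)

theorem hBracket_swap (i j : ℕ) : hBracket h j i = -hBracket h i j := by
  rw [hBracket, hBracket, osum_swap, add_comm]

/-- Splitting of the interval from `i` to `j + l` at `j`: this is the compatibility of the relations
for `[g, f]`, `[g, e]` and `[g, h]` with `{e, f} = h`. -/
theorem hBracket_add (i j l : ℕ) : hBracket h i (j + l) =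
    ∑ r ∈ Finset.range l, h (i + l - 1 - r) * h (j + r) +
      osum i j fun a => h (i + j - 1 - a) * h (a + l) := by
  have h1 : osum j (j + l) (fun c => h c * h (i + (j + l) - 1 - c)) =
      ∑ r ∈ Finset.range l, h (i + l - 1 - r) * h (j + r) := by
    rw [osum, Finset.sum_range_add, add_sub_cancel_left]
    refine Finset.sum_congr rfl fun r hr => ?_
    rw [mul_comm]
    congr 2; omega
  have h2 : osum i j (fun c => h c * h (i + (j + l) - 1 - c)) =
      osum i j fun a => h (i + j - 1 - a) * h (a + l) := by
    rw [← osum_reflect]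
    refine osum_congr fun a ha => ?_
    congr 2; omega
  rw [hBracket, ← osum_add_osum i j, h1, h2, add_comm]

/-- The compatibility of the relation for `[g_i, g_j]` with the commutators of `g` and `e`. -/
theorem hBracket_add_sub_hBracket_add (i j m : ℕ) :
    (hBracket h i (j + m) + ∑ t ∈ Finset.range m, h (j + m - 1 - t) * h (i + t)) -
      (hBracket h j (i + m) + ∑ t ∈ Finset.range m, h (i + m - 1 - t) * h (j + t)) =
      2 * osum i j fun a => h (i + j - 1 - a) * h (a + m) := by
  rw [hBracket_add, hBracket_add, osum_swap, add_comm j i]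
  ring

/-- The homogeneous version of `(x ^ i * y ^ j - x ^ j * y ^ i) / (y - x)`. -/
def divDiff (i j : ℕ) (x y : R) : R := osum i j fun a => x ^ (i + j - 1 - a) * y ^ a

theorem sub_mul_divDiff (i j : ℕ) (x y : R) :
    (y - x) * divDiff i j x y = x ^ i * y ^ j - x ^ j * y ^ i := by
  wlog hij : i ≤ j generalizing i j
  · have := this j i (by omega)
    rw [divDiff, osum_swap, add_comm i j, mul_neg, ← divDiff, this]; ring
  obtain ⟨d, rfl⟩ := Nat.exists_eq_add_of_le hij
  have h1 : divDiff i (i + d) x y =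
      x ^ i * y ^ i * ∑ a ∈ Finset.range d, y ^ a * x ^ (d - 1 - a) := by
    rw [divDiff, osum, Finset.sum_range_add, add_sub_cancel_left, Finset.mul_sum]
    refine Finset.sum_congr rfl fun a ha => ?_
    have := Finset.mem_range.1 ha
    rw [show i + (i + d) - 1 - (i + a) = i + (d - 1 - a) by omega, pow_add, pow_add]
    ring
  rw [h1, mul_left_comm, mul_comm (y - x), geom_sum₂_mul, pow_add, pow_add]
  ring

/-- The iterated divided difference which corresponds to an iterated bracket. -/
def divDiff₂ (i j l : ℕ) (x y z : R) : R :=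
  osum i j fun a => x ^ (i + j - 1 - a) * divDiff l a y z

theorem sub_mul_divDiff₂ (i j l : ℕ) (x y z : R) :
    (z - y) * divDiff₂ i j l x y z = y ^ l * divDiff i j x z - z ^ l * divDiff i j x y := by
  rw [divDiff₂, divDiff, divDiff, mul_osum, mul_osum, mul_osum, ← osum_sub]
  refine osum_congr fun a _ => ?_
  linear_combination x ^ (i + j - 1 - a) * sub_mul_divDiff l a y z

theorem vandermonde_mul_divDiff₂ (i j l : ℕ) (x y z : R) :
    (y - x) * (z - x) * (z - y) * divDiff₂ i j l x y z =
      (y - x) * y ^ l * (x ^ i * z ^ j - x ^ j * z ^ i) -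
        (z - x) * z ^ l * (x ^ i * y ^ j - x ^ j * y ^ i) := by
  linear_combination (y - x) * (z - x) * sub_mul_divDiff₂ i j l x y z +
    (y - x) * y ^ l * sub_mul_divDiff i j x z - (z - x) * z ^ l * sub_mul_divDiff i j x y

theorem sum_divDiff₂_eq_zero [IsDomain R] {x y z : R} (hxy : x ≠ y) (hyz : y ≠ z) (hxz : x ≠ z)
    (i j l : ℕ) :
    (divDiff₂ i j l x y z + divDiff₂ j l i x y z + divDiff₂ l i j x y z) +
      (divDiff₂ i j l y z x + divDiff₂ j l i y z x + divDiff₂ l i j y z x) +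
      (divDiff₂ i j l z x y + divDiff₂ j l i z x y + divDiff₂ l i j z x y) = 0 := by
  have hne : (y - x) * (z - x) * (z - y) ≠ 0 :=
    mul_ne_zero (mul_ne_zero (sub_ne_zero.2 hxy.symm) (sub_ne_zero.2 hxz.symm))
      (sub_ne_zero.2 hyz.symm)
  refine (mul_eq_zero.1 (?_ : (y - x) * (z - x) * (z - y) * _ = 0)).resolve_left hne
  have key := fun i j l (x y z : R) => vandermonde_mul_divDiff₂ i j l x y z
  linear_combination key i j l x y z + key j l i x y z + key l i j x y z +
    key i j l y z x + key j l i y z x + key l i j y z x +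
    key i j l z x y + key j l i z x y + key l i j z x y

end CommRing

section Jacobi

variable {R : Type*} [CommRing R] [Algebra ℚ R] (h : ℕ → R)

/-- The umbral functional `x^a y^b z^c ↦ h_a h_b h_c`. -/
def umbral : MvPolynomial (Fin 3) ℚ →ₗ[ℚ] R :=
  (MvPolynomial.basisMonomials (Fin 3) ℚ).constr ℚ fun m => h (m 0) * h (m 1) * h (m 2)

theorem umbral_monomial (m : Fin 3 →₀ ℕ) :
    umbral h (MvPolynomial.monomial m 1) = h (m 0) * h (m 1) * h (m 2) := by
  exact (MvPolynomial.basisMonomials (Fin 3) ℚ).constr_basis ℚ _ m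

theorem umbral_pow {p q r : Fin 3} (hpqr : ∀ f : Fin 3 → R, f p * f q * f r = f 0 * f 1 * f 2)
    (hpq : p ≠ q) (hpr : p ≠ r) (hqr : q ≠ r) (a b c : ℕ) :
    umbral h (MvPolynomial.X p ^ a * (MvPolynomial.X q ^ b * MvPolynomial.X r ^ c)) =
      h a * (h c * h b) := by
  rw [MvPolynomial.X_pow_eq_monomial, MvPolynomial.X_pow_eq_monomial,
    MvPolynomial.X_pow_eq_monomial, MvPolynomial.monomial_mul, MvPolynomial.monomial_mul, one_mul,
    one_mul, umbral_monomial, ← hpqr fun t => h _]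
  simp [hpq, hpr, hqr, hpq.symm, hpr.symm, hqr.symm, mul_assoc, mul_comm (h b)]

theorem umbral_divDiff₂ {p q r : Fin 3}
    (hpqr : ∀ f : Fin 3 → R, f p * f q * f r = f 0 * f 1 * f 2)
    (hpq : p ≠ q) (hpr : p ≠ r) (hqr : q ≠ r) (i j l : ℕ) :
    umbral h (divDiff₂ i j l (MvPolynomial.X p) (MvPolynomial.X q) (MvPolynomial.X r)) =
      osum i j fun a => h (i + j - 1 - a) * hBracket h l a := by
  have := fun a b c => umbral_pow h hpqr hpq hpr hqr a b c
  simp only [divDiff₂, divDiff, hBracket, mul_osum]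
  simp only [← LinearMap.toAddMonoidHom_coe, map_osum]
  simp only [LinearMap.toAddMonoidHom_coe, this]

/-- The Jacobi identity for the Poisson bracket `{h_i, h_j} = hBracket h i j`. Both sides being
symmetric trilinear in the `h_i`, it is the image under the umbral functional of an identity between
divided differences. -/
theorem osum_hBracket_cyclic (i j l : ℕ) :
    (osum i j fun a => h (i + j - 1 - a) * hBracket h l a) +
      (osum j l fun a => h (j + l - 1 - a) * hBracket h i a) +
      (osum l i fun a => h (l + i - 1 - a) * hBracket h j a) = 0 := by
  have hX : ∀ {p q : Fin 3}, p ≠ q → (MvPolynomial.X p : MvPolynomial (Fin 3) ℚ) ≠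
      MvPolynomial.X q := fun hpq hX => hpq (MvPolynomial.X_injective hX)
  have h0 := congrArg (umbral h) (sum_divDiff₂_eq_zero (R := MvPolynomial (Fin 3) ℚ)
    (x := MvPolynomial.X 0) (y := MvPolynomial.X 1) (z := MvPolynomial.X 2)
    (hX (by decide)) (hX (by decide)) (hX (by decide)) i j l)
  have e₀ := umbral_divDiff₂ h (p := 0) (q := 1) (r := 2) (fun f => rfl) (by decide) (by decide)
    (by decide)
  have e₁ := umbral_divDiff₂ h (p := 1) (q := 2) (r := 0) (fun f => by ring) (by decide)
    (by decide) (by decide)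
  have e₂ := umbral_divDiff₂ h (p := 2) (q := 0) (r := 1) (fun f => by ring) (by decide)
    (by decide) (by decide)
  simp only [map_add, map_zero, e₀, e₁, e₂] at h0
  generalize (osum i j fun a => h (i + j - 1 - a) * hBracket h l a) +
      (osum j l fun a => h (j + l - 1 - a) * hBracket h i a) +
      (osum l i fun a => h (l + i - 1 - a) * hBracket h j a) = J at h0 ⊢
  have h3 : (3 : ℚ) • J = 0 := by
    rw [← h0, show (3 : ℚ) = 1 + 1 + 1 by norm_num, add_smul, add_smul, one_smul]
  exact (smul_eq_zero.1 h3).resolve_left (by norm_num)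

/-- The Jacobi identity in the form in which it says that `[δ_i, δ_j] = 2 ∑ h δ` on the `h_l`. -/
theorem osum_hBracket_sub_osum_hBracket (i j l : ℕ) :
    (osum j l fun a => h (j + l - 1 - a) * hBracket h i a) -
      (osum i l fun a => h (i + l - 1 - a) * hBracket h j a) =
      osum i j fun a => h (i + j - 1 - a) * hBracket h a l := by
  have h1 := osum_hBracket_cyclic h i j l
  have h2 : (osum i j fun a => h (i + j - 1 - a) * hBracket h a l) =
      -osum i j fun a => h (i + j - 1 - a) * hBracket h l a := by
    rw [← osum_neg]
    exact osum_congr fun a _ => by rw [hBracket_swap h l a, mul_neg]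
  rw [h2, osum_swap l i, add_comm i l]
  linear_combination h1

/-- In the relation for `[g_i, g_j]` the order of the factors `g` and `h` does not matter. -/
theorem osum_hBracket_diagonal (i j : ℕ) :
    (osum i j fun a => hBracket h a (i + j - 1 - a)) = 0 := by
  have h1 := osum_reflect i j fun a => hBracket h a (i + j - 1 - a)
  have h2 : (osum i j fun a => hBracket h (i + j - 1 - a) (i + j - 1 - (i + j - 1 - a))) =
      -osum i j fun a => hBracket h a (i + j - 1 - a) := by
    rw [← osum_neg]
    refine osum_congr fun a ha => ?_
    rw [hBracket_swap, show i + j - 1 - (i + j - 1 - a) = a by omega]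
  rw [h2] at h1
  generalize (osum i j fun a => hBracket h a (i + j - 1 - a)) = s at h1 ⊢
  have h3 : (2 : ℚ) • s = 0 := by rw [two_smul]; nth_rewrite 1 [← h1]; exact neg_add_cancel s
  exact (smul_eq_zero.1 h3).resolve_left two_ne_zero

end Jacobi

end OrientedSum

/-! ### An oscillator representation of the algebra -/

/-- The variables of the oscillator representation. -/
inductive Osc (n : ℕ) : Type
  | h (j : ℕ) : Osc n
  | e (k : Fin n) (j : ℕ) : Osc n

instance (n : ℕ) : DecidableEq (Osc n) := Classical.decEq _

/-- The variables `e k j` anticommute for a fixed `k`, all others commute. -/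
def oscSign {n : ℕ} : Osc n → Osc n → ℚ
  | .e k _, .e l _ => if k = l then -1 else 1
  | .e _ _, .h _ => 1
  | .h _, _ => 1

theorem isColor_oscSign (n : ℕ) : IsColor (oscSign (n := n)) where
  symm := by rintro (i | ⟨k, i⟩) (j | ⟨l, j⟩) <;> simp [oscSign, eq_comm]
  sq := by
    rintro (i | ⟨k, i⟩) (j | ⟨l, j⟩) <;> simp only [oscSign, mul_one]
    split_ifs <;> norm_num
  odd_or_central := by
    rintro (i | ⟨k, i⟩)
    · exact Or.inr fun j => rfl
    · exact Or.inl (by simp [oscSign])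

section Oscillator

variable {n : ℕ} (L : ℕ)

/-- The space of the oscillator representation. -/
abbrev OscAlg (n : ℕ) : Type := ColorAlg (oscSign (n := n))

/-- The variable `e k j` of the oscillator representation. -/
abbrev oscE (k : Fin n) (j : ℕ) : OscAlg n := ColorAlg.X oscSign (Osc.e k j)

/-- The element by which the generator `h j` acts: the variable `h j`, shifted by `1` for `j = L`. -/
def oscH (j : ℕ) : OscAlg n := ColorAlg.X oscSign (Osc.h j) + if j = L then 1 else 0

theorem X_h_mul_comm (j : ℕ) (a : OscAlg n) :
    ColorAlg.X oscSign (Osc.h j) * a = a * ColorAlg.X oscSign (Osc.h j) := by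
  induction a using ColorAlg.induction with
  | one => simp
  | add a b ha hb => rw [mul_add, add_mul, ha, hb]
  | smul c a ha => rw [mul_smul_comm, smul_mul_assoc, ha]
  | mul i a ha => rw [← mul_assoc, ColorAlg.X_mul_X, oscSign, one_smul, mul_assoc, ha, mul_assoc]

theorem oscH_mul_comm (j : ℕ) (a : OscAlg n) : oscH L j * a = a * oscH L j := by
  rw [oscH, add_mul, mul_add, X_h_mul_comm]
  split_ifs <;> simp

/-- The homomorphism `h_j ↦ oscH L j` from the polynomial ring to the centre. -/
def oscCenter (n : ℕ) : MvPolynomial ℕ ℚ →ₐ[ℚ] Subalgebra.center ℚ (OscAlg n) :=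
  MvPolynomial.aeval fun j => ⟨oscH L j, Subalgebra.mem_center_iff.2 fun a =>
    (oscH_mul_comm L j a).symm⟩

/-- The homomorphism `h_j ↦ oscH L j` from the polynomial ring. -/
def oscPoly (n : ℕ) : MvPolynomial ℕ ℚ →ₐ[ℚ] OscAlg n :=
  (Subalgebra.center ℚ (OscAlg n)).val.comp (oscCenter L n)

theorem oscPoly_X (j : ℕ) : oscPoly L n (MvPolynomial.X j) = oscH L j := by
  simp [oscPoly, oscCenter]

theorem oscPoly_mul_comm (p : MvPolynomial ℕ ℚ) (a : OscAlg n) :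
    oscPoly L n p * a = a * oscPoly L n p :=
  (Subalgebra.mem_center_iff.1 (oscCenter L n p).2 a).symm

/-- To show that an operator vanishes, it suffices that it kills `1`, commutes with all `oscH`, and
commutes up to scalars with all `oscE`. -/
theorem osc_end_eq_zero {Z : Module.End ℚ (OscAlg n)} (h₁ : Z 1 = 0)
    (hh : ∀ l a, Z (oscH L l * a) = oscH L l * Z a)
    (he : ∀ k l, ∃ c : ℚ, ∀ a, Z (oscE k l * a) = c • (oscE k l * Z a)) (a : OscAlg n) :
    Z a = 0 := by
  refine ColorAlg.linearMap_eq_zero h₁ ?_ a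
  rintro (l | ⟨k, l⟩)
  · refine ⟨1, fun a => ?_⟩
    have := hh l a
    rw [one_smul]
    simp only [oscH, add_mul, map_add] at this
    split_ifs at this <;> simpa using this
  · exact he k l

/-! ### The operators of the generators `f` -/

/-- The values on the variables of the operator of `f k j`. -/
def oscFVal (k : Fin n) (j : ℕ) : Osc n → OscAlg n
  | .h _ => 0
  | .e l i => if l = k then oscH L (i + j) else 0

theorem exists_oscF (k : Fin n) (j : ℕ) :
    ∃ D : Module.End ℚ (OscAlg n), (∀ i, D (ColorAlg.X oscSign i) = oscFVal L k j i) ∧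
      ∀ a b, D (a * b) = D a * b + ColorAlg.signHom (Osc.e k 0) a * D b := by
  refine ColorAlg.exists_twisted_derivation (isColor_oscSign n) _ _ fun i i' => ?_
  rcases i with _ | ⟨l, i⟩
  · simp [oscFVal]
  · rw [oscFVal]
    split_ifs with h
    · subst h
      rw [ColorAlg.signHom_X, oscH_mul_comm, smul_mul_assoc, smul_smul]
      have : oscSign (Osc.e l i) i' * oscSign (Osc.e l 0) i' = 1 := by
        rw [show oscSign (Osc.e l i) i' = oscSign (Osc.e l 0) i' by cases i' <;> rfl]
        exact (isColor_oscSign n).sq _ _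
      rw [this, one_smul]
    · simp

/-- The operator of `f k j`: a twisted derivation which maps `e k i` to `oscH L (i + j)`. -/
def oscF (k : Fin n) (j : ℕ) : Module.End ℚ (OscAlg n) := (exists_oscF L k j).choose

theorem oscF_X (k : Fin n) (j : ℕ) (i : Osc n) :
    oscF L k j (ColorAlg.X oscSign i) = oscFVal L k j i :=
  (exists_oscF L k j).choose_spec.1 i

theorem oscF_mul (k : Fin n) (j : ℕ) (a b : OscAlg n) :
    oscF L k j (a * b) = oscF L k j a * b + ColorAlg.signHom (Osc.e k 0) a * oscF L k j b :=
  (exists_oscF L k j).choose_spec.2 a b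

theorem oscF_one (k : Fin n) (j : ℕ) : oscF L k j 1 = 0 := by
  simpa using oscF_mul L k j 1 1

theorem oscF_oscE_mul_same (k : Fin n) (j l : ℕ) (a : OscAlg n) :
    oscF L k j (oscE k l * a) = oscH L (l + j) * a - oscE k l * oscF L k j a := by
  rw [oscF_mul, oscF_X, ColorAlg.signHom_X]
  simp [oscFVal, oscSign, sub_eq_add_neg]

theorem oscF_oscE_mul_ne {k m : Fin n} (hkm : k ≠ m) (j l : ℕ) (a : OscAlg n) :
    oscF L k j (oscE m l * a) = oscE m l * oscF L k j a := by
  rw [oscF_mul, oscF_X, ColorAlg.signHom_X]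
  simp [oscFVal, oscSign, hkm, hkm.symm]

theorem oscF_oscH_mul (k : Fin n) (j l : ℕ) (a : OscAlg n) :
    oscF L k j (oscH L l * a) = oscH L l * oscF L k j a := by
  rw [oscH, add_mul, map_add, oscF_mul, oscF_X, ColorAlg.signHom_X, add_mul]
  split_ifs <;> simp [oscFVal, oscSign]

theorem oscF_oscPoly_mul (k : Fin n) (j : ℕ) (p : MvPolynomial ℕ ℚ) (a : OscAlg n) :
    oscF L k j (oscPoly L n p * a) = oscPoly L n p * oscF L k j a := by
  induction p using MvPolynomial.induction_on generalizing a with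
  | C c =>
    rw [← MvPolynomial.algebraMap_eq, AlgHom.commutes, ← Algebra.smul_def, map_smul,
      ← Algebra.smul_def]
  | add p q hp hq => rw [map_add, add_mul, map_add, hp, hq, add_mul]
  | mul_X p i hp => rw [map_mul (oscPoly L n), oscPoly_X, mul_assoc, hp, oscF_oscH_mul, mul_assoc]

/-! ### The operators of the generators `g` -/

/-- The values on the variables of the operator of `g i`. -/
def oscGVal (i : ℕ) : Osc n → OscAlg n
  | .h j => oscPoly L n (hBracket MvPolynomial.X i j)
  | .e k j => ∑ r ∈ Finset.range j, oscH L (i + (j - 1 - r)) * oscE k r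

theorem exists_oscG (i : ℕ) :
    ∃ D : Module.End ℚ (OscAlg n), (∀ j, D (ColorAlg.X oscSign j) = oscGVal L i j) ∧
      ∀ a b, D (a * b) = D a * b + AlgHom.id ℚ (OscAlg n) a * D b := by
  refine ColorAlg.exists_twisted_derivation (isColor_oscSign n) _ _ fun j j' => ?_
  rcases j with j | ⟨k, j⟩
  · rw [oscGVal, oscPoly_mul_comm, oscSign, one_smul, AlgHom.id_apply]
  · rw [oscGVal, AlgHom.id_apply, Finset.sum_mul, Finset.mul_sum, Finset.smul_sum]
    refine Finset.sum_congr rfl fun r _ => ?_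
    rw [mul_assoc, ColorAlg.X_mul_X,
      show oscSign (Osc.e k r) j' = oscSign (Osc.e k j) j' by cases j' <;> rfl,
      mul_smul_comm, ← mul_assoc, ← mul_assoc, oscH_mul_comm]

/-- The operator of `g i`: the derivation which gives the commutators of `g i` with `h` and `e`. -/
def oscG (i : ℕ) : Module.End ℚ (OscAlg n) := (exists_oscG L i).choose

theorem oscG_X (i : ℕ) (j : Osc n) : oscG L i (ColorAlg.X oscSign j) = oscGVal L i j :=
  (exists_oscG L i).choose_spec.1 j

theorem oscG_mul (i : ℕ) (a b : OscAlg n) : oscG L i (a * b) = oscG L i a * b + a * oscG L i b :=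
  (exists_oscG L i).choose_spec.2 a b

theorem oscG_one (i : ℕ) : oscG L i (1 : OscAlg n) = 0 := by
  simpa using oscG_mul L i (1 : OscAlg n) 1

theorem oscG_oscE_mul (i : ℕ) (k : Fin n) (j : ℕ) (a : OscAlg n) :
    oscG L i (oscE k j * a) =
      (∑ r ∈ Finset.range j, oscH L (i + (j - 1 - r)) * (oscE k r * a)) +
        oscE k j * oscG L i a := by
  rw [oscG_mul, oscG_X, oscGVal, Finset.sum_mul]
  simp only [mul_assoc]

theorem oscG_oscH (i j : ℕ) :
    oscG L i (oscH L j : OscAlg n) = oscPoly L n (hBracket MvPolynomial.X i j) := by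
  rw [oscH, map_add, oscG_X, oscGVal]
  split_ifs <;> simp [oscG_one]

theorem oscG_oscH_mul (i j : ℕ) (a : OscAlg n) :
    oscG L i (oscH L j * a) =
      oscPoly L n (hBracket MvPolynomial.X i j) * a + oscH L j * oscG L i a := by
  rw [oscG_mul, oscG_oscH]

/-- The derivation of the polynomial ring in the `h_j` which corresponds to `g i`. -/
def hDer (i : ℕ) : Derivation ℚ (MvPolynomial ℕ ℚ) (MvPolynomial ℕ ℚ) :=
  MvPolynomial.mkDerivation ℚ fun j => hBracket MvPolynomial.X i j

theorem oscG_oscPoly (i : ℕ) (p : MvPolynomial ℕ ℚ) :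
    oscG L i (oscPoly L n p) = oscPoly L n (hDer i p) := by
  induction p using MvPolynomial.induction_on with
  | C c =>
    rw [← MvPolynomial.algebraMap_eq, AlgHom.commutes, Derivation.map_algebraMap,
      Algebra.algebraMap_eq_smul_one, map_smul, oscG_one, smul_zero, map_zero]
  | add p q hp hq => rw [map_add, map_add, hp, hq, map_add, map_add]
  | mul_X p j hp =>
    rw [map_mul, oscG_mul, hp, oscPoly_X, oscG_oscH, Derivation.leibniz, map_add, smul_eq_mul,
      smul_eq_mul, map_mul, map_mul, oscPoly_X, hDer, MvPolynomial.mkDerivation_X,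
      oscH_mul_comm L j, add_comm]

theorem oscG_oscPoly_mul (i : ℕ) (p : MvPolynomial ℕ ℚ) (a : OscAlg n) :
    oscG L i (oscPoly L n p * a) =
      oscPoly L n (hDer i p) * a + oscPoly L n p * oscG L i a := by
  rw [oscG_mul, oscG_oscPoly]

theorem hDer_hBracket (i j l : ℕ) :
    hDer i (hBracket MvPolynomial.X j l) = 2 * osum j l fun a =>
      MvPolynomial.X (j + l - 1 - a) * hBracket MvPolynomial.X i a := by
  have h1 : hDer i (hBracket MvPolynomial.X j l) = osum j l fun c => hDer i
      (MvPolynomial.X c * MvPolynomial.X (j + l - 1 - c)) :=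
    map_osum ((hDer i : MvPolynomial ℕ ℚ →ₗ[ℚ] MvPolynomial ℕ ℚ).toAddMonoidHom) _ _ _
  have h2 := osum_reflect j l fun a =>
      (MvPolynomial.X (j + l - 1 - a) * hBracket MvPolynomial.X i a : MvPolynomial ℕ ℚ)
  rw [h1, two_mul]
  nth_rewrite 1 [← h2]
  rw [← osum_add]
  refine osum_congr fun a ha => ?_
  rw [Derivation.leibniz, smul_eq_mul, smul_eq_mul, hDer, MvPolynomial.mkDerivation_X,
    MvPolynomial.mkDerivation_X, show j + l - 1 - (j + l - 1 - a) = a by omega]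

/-! ### The relations between the operators -/

theorem oscF_anticomm_same (k : Fin n) (i j : ℕ) (a : OscAlg n) :
    oscF L k i (oscF L k j a) + oscF L k j (oscF L k i a) = 0 := by
  refine osc_end_eq_zero L (Z := oscF L k i * oscF L k j + oscF L k j * oscF L k i) ?_ ?_ ?_ a
  · simp [oscF_one]
  · intro l a; simp [oscF_oscH_mul, mul_add]
  · intro m l
    by_cases hm : k = m
    · subst hm
      refine ⟨1, fun a => ?_⟩
      simp [oscF_oscE_mul_same, oscF_oscH_mul, mul_add]
      abel
    · refine ⟨1, fun a => ?_⟩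
      simp [oscF_oscE_mul_ne L hm, mul_add]

theorem oscF_comm_ne {k k' : Fin n} (hk : k ≠ k') (i j : ℕ) (a : OscAlg n) :
    oscF L k i (oscF L k' j a) - oscF L k' j (oscF L k i a) = 0 := by
  refine osc_end_eq_zero L (Z := oscF L k i * oscF L k' j - oscF L k' j * oscF L k i) ?_ ?_ ?_ a
  · simp [oscF_one]
  · intro l a; simp [oscF_oscH_mul, mul_sub]
  · intro m l
    by_cases hm : k = m
    · subst hm
      refine ⟨-1, fun a => ?_⟩
      simp [oscF_oscE_mul_same, oscF_oscE_mul_ne L hk.symm, oscF_oscH_mul, mul_sub]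
    · by_cases hm' : k' = m
      · subst hm'
        refine ⟨-1, fun a => ?_⟩
        simp [oscF_oscE_mul_same, oscF_oscE_mul_ne L hk, oscF_oscH_mul, mul_sub]
      · refine ⟨1, fun a => ?_⟩
        simp [oscF_oscE_mul_ne L hm, oscF_oscE_mul_ne L hm', mul_sub]

/-- The commutator of the operators of `g i` and `f k j`. -/
theorem oscG_oscF (k : Fin n) (i j : ℕ) (a : OscAlg n) :
    oscG L i (oscF L k j a) - oscF L k j (oscG L i a) =
      osum i j fun c => oscH L (i + j - 1 - c) * oscF L k c a := by
  let W : Module.End ℚ (OscAlg n) :=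
    osum i j fun c => LinearMap.mulLeft ℚ (oscH L (i + j - 1 - c)) * oscF L k c
  have hW : ∀ a, W a = osum i j fun c => oscH L (i + j - 1 - c) * oscF L k c a := fun a =>
    map_osum (LinearMap.applyₗ (R := ℚ) a : Module.End ℚ (OscAlg n) →ₗ[ℚ] _).toAddMonoidHom _ _ _
  rw [← hW, ← sub_eq_zero]
  have hWh : ∀ l a, W (oscH L l * a) = oscH L l * W a := by
    intro l a
    rw [hW, hW, mul_osum]
    refine osum_congr fun c _ => ?_
    rw [oscF_oscH_mul, ← mul_assoc, ← mul_assoc, oscH_mul_comm]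
  refine osc_end_eq_zero L (Z := oscG L i * oscF L k j - oscF L k j * oscG L i - W) ?_ ?_ ?_ a
  · simp [oscF_one, oscG_one, hW, osum]
  · intro l a
    simp [hWh, oscF_oscH_mul, oscG_oscH_mul, oscF_oscPoly_mul, mul_sub]
  · intro m l
    by_cases hm : k = m
    · subst hm
      refine ⟨-1, fun a => ?_⟩
      have hWe : W (oscE k l * a) = oscPoly L n (osum i j fun c =>
          MvPolynomial.X (i + j - 1 - c) * MvPolynomial.X (c + l)) * a - oscE k l * W a := by
        have h1 : oscPoly L n (osum i j fun c =>
            MvPolynomial.X (i + j - 1 - c) * MvPolynomial.X (c + l)) =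
            osum i j fun c => oscH L (i + j - 1 - c) * oscH L (c + l) := by
          refine (map_osum (oscPoly L n : MvPolynomial ℕ ℚ →+ OscAlg n) _ _ _).trans ?_
          simp [oscPoly_X]
        rw [h1, hW, hW, osum_mul, mul_osum, ← osum_sub]
        refine osum_congr fun c _ => ?_
        rw [oscF_oscE_mul_same, mul_sub, ← mul_assoc, ← mul_assoc, ← mul_assoc,
          oscH_mul_comm L _ (oscE k l), add_comm c l]
      have hsum : (∑ r ∈ Finset.range l,
            oscF L k j (oscH L (i + (l - 1 - r)) * (oscE k r * a))) =
          oscPoly L n (∑ r ∈ Finset.range l,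
            MvPolynomial.X (i + l - 1 - r) * MvPolynomial.X (j + r)) * a -
          ∑ r ∈ Finset.range l, oscH L (i + (l - 1 - r)) * (oscE k r * oscF L k j a) := by
        rw [map_sum, Finset.sum_mul, ← Finset.sum_sub_distrib]
        refine Finset.sum_congr rfl fun r hr => ?_
        have := Finset.mem_range.1 hr
        rw [oscF_oscH_mul, oscF_oscE_mul_same, map_mul, oscPoly_X, oscPoly_X, mul_sub, mul_assoc,
          show i + (l - 1 - r) = i + l - 1 - r by omega, add_comm r j]
      have hB := congrArg (fun p => oscPoly L n p * a)
        (hBracket_add (MvPolynomial.X : ℕ → MvPolynomial ℕ ℚ) i j l)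
      simp only [map_add, add_mul] at hB
      simp only [LinearMap.sub_apply, Module.End.mul_apply, hWe, oscF_oscE_mul_same, map_sub,
        oscG_oscH_mul, oscG_oscE_mul, map_add, map_sum, hsum, add_comm l j, hB, mul_sub,
        neg_smul, one_smul]
      abel
    · refine ⟨1, fun a => ?_⟩
      have hWe : W (oscE m l * a) = oscE m l * W a := by
        rw [hW, hW, mul_osum]
        refine osum_congr fun c _ => ?_
        rw [oscF_oscE_mul_ne L hm, ← mul_assoc, ← mul_assoc, oscH_mul_comm]
      simp [hWe, oscF_oscE_mul_ne L hm, oscG_oscE_mul, oscF_oscH_mul, mul_sub]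

theorem sum_triangle {M : Type*} [AddCommMonoid M] (l : ℕ) (φ : ℕ → ℕ → M) :
    (∑ r ∈ Finset.range l, ∑ q ∈ Finset.range r, φ r q) =
      ∑ q ∈ Finset.range l, ∑ t ∈ Finset.range (l - 1 - q), φ (q + 1 + t) q := by
  rw [Finset.sum_comm' (t' := Finset.range l) (s' := fun q => Finset.Ico (q + 1) l)
    (by intro r q; simp only [Finset.mem_range, Finset.mem_Ico]; omega)]
  refine Finset.sum_congr rfl fun q _ => ?_
  rw [Finset.sum_Ico_eq_sum_range, show l - (q + 1) = l - 1 - q by omega]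

/-- The action of `g i` and `g j` on a multiple of `e k l`; the sum of the second and the
third term is symmetric in `i` and `j`. -/
theorem oscG_oscG_oscE_mul (i j : ℕ) (k : Fin n) (l : ℕ) (a : OscAlg n) :
    oscG L i (oscG L j (oscE k l * a)) =
      (∑ q ∈ Finset.range l, oscPoly L n (hBracket MvPolynomial.X i (j + (l - 1 - q)) +
          ∑ t ∈ Finset.range (l - 1 - q),
            MvPolynomial.X (j + (l - 1 - q) - 1 - t) * MvPolynomial.X (i + t)) * (oscE k q * a)) +
        (∑ r ∈ Finset.range l, oscH L (j + (l - 1 - r)) * (oscE k r * oscG L i a)) +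
        (∑ r ∈ Finset.range l, oscH L (i + (l - 1 - r)) * (oscE k r * oscG L j a)) +
        oscE k l * oscG L i (oscG L j a) := by
  have h1 : (∑ r ∈ Finset.range l, ∑ q ∈ Finset.range r,
      oscH L (j + (l - 1 - r)) * (oscH L (i + (r - 1 - q)) * (oscE k q * a))) =
      ∑ q ∈ Finset.range l, oscPoly L n (∑ t ∈ Finset.range (l - 1 - q),
        MvPolynomial.X (j + (l - 1 - q) - 1 - t) * MvPolynomial.X (i + t)) * (oscE k q * a) := by
    rw [sum_triangle]
    refine Finset.sum_congr rfl fun q hq => ?_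
    rw [map_sum, Finset.sum_mul]
    refine Finset.sum_congr rfl fun t ht => ?_
    have := Finset.mem_range.1 ht
    rw [map_mul, oscPoly_X, oscPoly_X, mul_assoc,
      show j + (l - 1 - (q + 1 + t)) = j + (l - 1 - q) - 1 - t by omega,
      show q + 1 + t - 1 - q = t by omega]
  rw [oscG_oscE_mul, map_add, map_sum, oscG_oscE_mul]
  simp only [oscG_oscH_mul, oscG_oscE_mul, mul_add, Finset.mul_sum, Finset.sum_add_distrib, h1,
    map_add, add_mul]
  abel

/-- The commutator of the operators of `g i` and `g j`. -/
theorem oscG_oscG (i j : ℕ) (a : OscAlg n) :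
    oscG L i (oscG L j a) - oscG L j (oscG L i a) =
      2 * osum i j fun c => oscH L (i + j - 1 - c) * oscG L c a := by
  let W : Module.End ℚ (OscAlg n) :=
    osum i j fun c => LinearMap.mulLeft ℚ (oscH L (i + j - 1 - c)) * oscG L c
  have hW : ∀ a, W a = osum i j fun c => oscH L (i + j - 1 - c) * oscG L c a := fun a =>
    map_osum (LinearMap.applyₗ (R := ℚ) a : Module.End ℚ (OscAlg n) →ₗ[ℚ] _).toAddMonoidHom _ _ _
  have hW2 : ∀ a, (2 * W) a = 2 * W a := fun a => by
    rw [two_mul, two_mul, LinearMap.add_apply]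
  rw [← hW, ← hW2, ← sub_eq_zero]
  refine osc_end_eq_zero L (Z := oscG L i * oscG L j - oscG L j * oscG L i - 2 * W) ?_ ?_ ?_ a
  · rw [LinearMap.sub_apply, hW2, hW]
    simp [oscG_one, osum]
  · intro l a
    have hWh : W (oscH L l * a) = oscPoly L n (osum i j fun c =>
        MvPolynomial.X (i + j - 1 - c) * hBracket MvPolynomial.X c l) * a + oscH L l * W a := by
      have h1 : oscPoly L n (osum i j fun c =>
            MvPolynomial.X (i + j - 1 - c) * hBracket MvPolynomial.X c l) =
            osum i j fun c => oscH L (i + j - 1 - c) *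
              oscPoly L n (hBracket MvPolynomial.X c l) := by
        refine (map_osum (oscPoly L n : MvPolynomial ℕ ℚ →+ OscAlg n) _ _ _).trans ?_
        simp [oscPoly_X]
      rw [h1, hW, hW, osum_mul, mul_osum, ← osum_add]
      refine osum_congr fun c _ => ?_
      rw [oscG_oscH_mul, mul_add, ← mul_assoc, ← mul_assoc, ← mul_assoc,
        oscH_mul_comm L _ (oscH L l)]
    have hJ := congrArg (fun p => oscPoly L n (2 * p) * a)
      (osum_hBracket_sub_osum_hBracket (MvPolynomial.X : ℕ → MvPolynomial ℕ ℚ) i j l)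
    simp only [mul_sub, ← hDer_hBracket, map_sub, sub_mul, map_mul, map_ofNat] at hJ
    simp only [LinearMap.sub_apply, hW2, Module.End.mul_apply, oscG_oscH_mul, map_add,
      oscG_oscPoly_mul, hWh, mul_add, mul_sub]
    rw [← sub_eq_zero] at hJ ⊢
    rw [← hJ, two_mul (oscH L l * W a), two_mul (W a), mul_add]
    simp only [mul_assoc]
    abel
  · intro k l
    refine ⟨1, fun a => ?_⟩
    have hWe : 2 * W (oscE k l * a) = (∑ q ∈ Finset.range l,
        oscPoly L n (2 * osum i j fun c =>
          MvPolynomial.X (i + j - 1 - c) * MvPolynomial.X (c + (l - 1 - q))) * (oscE k q * a)) +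
        oscE k l * (2 * W a) := by
      have h1 : ∀ q, oscPoly L n (osum i j fun c =>
            MvPolynomial.X (i + j - 1 - c) * MvPolynomial.X (c + (l - 1 - q))) =
            osum i j fun c => oscH L (i + j - 1 - c) * oscH L (c + (l - 1 - q)) := by
        intro q
        refine (map_osum (oscPoly L n : MvPolynomial ℕ ℚ →+ OscAlg n) _ _ _).trans ?_
        simp [oscPoly_X]
      have h2 : W (oscE k l * a) = (∑ q ∈ Finset.range l,
          oscPoly L n (osum i j fun c =>
            MvPolynomial.X (i + j - 1 - c) * MvPolynomial.X (c + (l - 1 - q))) * (oscE k q * a)) +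
          oscE k l * W a := by
        simp only [h1, osum_mul]
        rw [← osum_sum, hW, hW, mul_osum, ← osum_add]
        refine osum_congr fun c _ => ?_
        rw [oscG_oscE_mul, mul_add, Finset.mul_sum]
        simp only [← mul_assoc]
        rw [oscH_mul_comm L _ (oscE k l)]
      rw [h2, mul_add, Finset.mul_sum, ← mul_assoc, two_mul (oscE k l), ← mul_two, mul_assoc]
      simp only [map_mul, map_ofNat, mul_assoc]
    have hB : ∀ q, oscPoly L n (hBracket MvPolynomial.X i (j + (l - 1 - q)) +
          ∑ t ∈ Finset.range (l - 1 - q),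
            MvPolynomial.X (j + (l - 1 - q) - 1 - t) * MvPolynomial.X (i + t)) * (oscE k q * a) =
        oscPoly L n (hBracket MvPolynomial.X j (i + (l - 1 - q)) +
          ∑ t ∈ Finset.range (l - 1 - q),
            MvPolynomial.X (i + (l - 1 - q) - 1 - t) * MvPolynomial.X (j + t)) * (oscE k q * a) +
        oscPoly L n (2 * osum i j fun c =>
          MvPolynomial.X (i + j - 1 - c) * MvPolynomial.X (c + (l - 1 - q))) * (oscE k q * a) := by
      intro q
      rw [← add_mul, ← map_add, ← hBracket_add_sub_hBracket_add, add_sub_cancel]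
    rw [one_smul]
    simp only [LinearMap.sub_apply, hW2, Module.End.mul_apply, oscG_oscG_oscE_mul, hWe, mul_sub, hB,
      Finset.sum_add_distrib]
    abel

/-! ### The action of the algebra -/

/-- The operators of the generators. -/
def oscOp : Gen n → Module.End ℚ (OscAlg n)
  | .g i => oscG L i
  | .h i => LinearMap.mulLeft ℚ (oscH L i)
  | .e k i => LinearMap.mulLeft ℚ (oscE k i)
  | .f k i => oscF L k i

theorem oscOp_rel {u v : Free n} (huv : Rel n u v) :
    FreeAlgebra.lift ℚ (oscOp L) u = FreeAlgebra.lift ℚ (oscOp L) v := by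
  have hsub : ∀ {i j r : ℕ}, r ∈ Finset.range (j - i) → i + j - 1 - (j - 1 - r) = r + i := by
    intro i j r hr
    have := Finset.mem_range.1 hr
    omega
  cases huv with
  | ee k i j =>
    ext a
    have : oscE k i * oscE k j = -(oscE k j * oscE k i) := by
      rw [ColorAlg.X_mul_X]; simp [oscSign]
    simp [anticomm, E, oscOp, ← mul_assoc, this]
  | ff k i j =>
    ext a
    simpa [anticomm, F, oscOp] using oscF_anticomm_same L k i j a
  | ef k i j =>
    ext a
    simp [anticomm, E, F, H, oscOp, oscF_oscE_mul_same]
  | ee_ne k l hkl i j =>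
    ext a
    have : oscE k i * oscE l j = oscE l j * oscE k i := by
      rw [ColorAlg.X_mul_X]; simp [oscSign, hkl]
    simp [comm, E, oscOp, ← mul_assoc, this]
  | ff_ne k l hkl i j =>
    ext a
    simpa [comm, F, oscOp] using oscF_comm_ne L hkl i j a
  | ef_ne k l hkl i j =>
    ext a
    simp [comm, E, F, oscOp, oscF_oscE_mul_ne L hkl.symm]
  | he k i j =>
    ext a
    simp [comm, E, H, oscOp, ← mul_assoc, oscH_mul_comm L i (oscE k j)]
  | hf k i j =>
    ext a
    simp [comm, F, H, oscOp, oscF_oscH_mul]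
  | hh i j =>
    ext a
    simp [comm, H, oscOp, ← mul_assoc, oscH_mul_comm L i (oscH L j)]
  | ge k i j =>
    ext a
    simp [comm, E, G, H, oscOp, oscG_oscE_mul]
  | gf_anti k i j =>
    ext a
    have h1 := oscG_oscF L k i j a
    rw [osum_swap, add_comm i j, ← oscG_oscF] at h1
    simpa [comm, G, F, oscOp] using h1
  | gf k i j hij =>
    ext a
    have h1 := oscG_oscF L k i j a
    rw [osum_eq_sum hij] at h1
    simp only [comm, G, F, H, oscOp, map_sub, map_mul, FreeAlgebra.lift_ι_apply, map_sum,
      LinearMap.sub_apply, LinearMap.sum_apply, Module.End.mul_apply, LinearMap.mulLeft_apply,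
      oscF_oscH_mul, h1]
    exact Finset.sum_congr rfl fun r hr => by rw [hsub hr]
  | gh_anti i j =>
    ext a
    simp only [comm, G, H, oscOp, map_sub, map_mul, map_neg, FreeAlgebra.lift_ι_apply,
      LinearMap.sub_apply, LinearMap.neg_apply, Module.End.mul_apply, LinearMap.mulLeft_apply,
      oscG_oscH_mul, add_sub_cancel_right, hBracket_swap _ j i, neg_mul]
  | gh i j hij =>
    ext a
    simp only [comm, G, H, oscOp, map_sub, map_mul, FreeAlgebra.lift_ι_apply, map_sum,
      LinearMap.sub_apply, LinearMap.sum_apply, Module.End.mul_apply, LinearMap.mulLeft_apply,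
      oscG_oscH_mul, add_sub_cancel_right, hBracket, osum_eq_sum hij, Finset.sum_mul, oscPoly_X,
      mul_assoc]
    exact Finset.sum_congr rfl fun r hr => by rw [hsub hr]
  | gg i j hij =>
    ext a
    have h1 := oscG_oscG L i j a
    -- the order of `g` and `h` in the relation does not matter
    have h2 : (osum i j fun c => oscG L c (oscH L (i + j - 1 - c) * a)) =
        osum i j fun c => oscH L (i + j - 1 - c) * oscG L c a := by
      have h3 : oscPoly L n (osum i j fun c => hBracket MvPolynomial.X c (i + j - 1 - c)) =
          osum i j fun c => oscPoly L n (hBracket MvPolynomial.X c (i + j - 1 - c)) :=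
        map_osum (oscPoly L n : MvPolynomial ℕ ℚ →+ OscAlg n) _ _ _
      rw [osum_hBracket_diagonal, map_zero] at h3
      simp only [oscG_oscH_mul]
      rw [osum_add, ← osum_mul, ← h3, zero_mul, zero_add]
    rw [← h2, osum_eq_sum hij, two_mul] at h1
    simp only [comm, G, H, oscOp, map_sub, map_mul, two_mul, map_add,
      FreeAlgebra.lift_ι_apply, map_sum,
      LinearMap.sub_apply, LinearMap.add_apply, LinearMap.sum_apply, Module.End.mul_apply,
      LinearMap.mulLeft_apply, h1]
    congr 1 <;> exact Finset.sum_congr rfl fun r hr => by rw [hsub hr]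

/-- The oscillator representation. -/
def oscRep : P n →ₐ[ℚ] Module.End ℚ (OscAlg n) :=
  RingQuot.liftAlgHom ℚ ⟨FreeAlgebra.lift ℚ (oscOp L), fun _ _ => oscOp_rel L⟩

theorem oscRep_gen (x : Gen n) : oscRep L (gen x) = oscOp L x :=
  (RingQuot.liftAlgHom_mkAlgHom_apply _ _ _ _).trans (FreeAlgebra.lift_ι_apply _ x)

end Oscillator

/-! ### The words of the ordered monomials -/

instance (n : ℕ) : DecidableEq (Gen n) := Classical.decEq _

section PBWWord

variable {n : ℕ}

/-- The `g`'s of an ordered monomial. -/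
def gPart (s : PBWIndex n) : List (Gen n) := s.a.1.map Gen.g

/-- The `h`'s and `e`'s of an ordered monomial. -/
def hePart (s : PBWIndex n) : List (Gen n) :=
  s.b.1.map Gen.h ++ (List.ofFn fun k => (s.c k).1.map (Gen.e k)).flatten

/-- The `f`'s of an ordered monomial. -/
def fPart (s : PBWIndex n) : List (Gen n) :=
  (List.ofFn fun k => (s.d k).1.map (Gen.f k)).flatten

/-- The word of an ordered monomial. -/
def pbwWord (s : PBWIndex n) : List (Gen n) := gPart s ++ (hePart s ++ fPart s)

theorem pbwMonomial_eq (s : PBWIndex n) : pbwMonomial s = ((pbwWord s).map gen).prod := by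
  simp [pbwMonomial, pbwWord, gPart, hePart, fPart, List.map_flatten, List.prod_flatten,
    List.map_ofFn, Function.comp_def, mul_assoc]

theorem exists_of_mem_gPart {s : PBWIndex n} {x : Gen n} (h : x ∈ gPart s) : ∃ i, x = Gen.g i := by
  obtain ⟨i, _, rfl⟩ := List.mem_map.1 h
  exact ⟨i, rfl⟩

theorem exists_of_mem_hePart {s : PBWIndex n} {x : Gen n} (h : x ∈ hePart s) :
    (∃ i, x = Gen.h i) ∨ ∃ k i, x = Gen.e k i := by
  simp only [hePart, List.mem_append, List.mem_map, List.mem_flatten, List.mem_ofFn] at h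
  rcases h with ⟨i, _, rfl⟩ | ⟨_, ⟨k, rfl⟩, h⟩
  · exact Or.inl ⟨i, rfl⟩
  · obtain ⟨i, _, rfl⟩ := List.mem_map.1 h
    exact Or.inr ⟨k, i, rfl⟩

theorem exists_of_mem_fPart {s : PBWIndex n} {x : Gen n} (h : x ∈ fPart s) :
    ∃ k i, x = Gen.f k i := by
  simp only [fPart, List.mem_flatten, List.mem_ofFn] at h
  obtain ⟨_, ⟨k, rfl⟩, h⟩ := h
  obtain ⟨i, _, rfl⟩ := List.mem_map.1 h
  exact ⟨k, i, rfl⟩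

theorem count_flatten_ofFn {X : Fin n → ℕ → Gen n} (hX : Function.Injective2 X)
    (c : Fin n → List ℕ) (k : Fin n) (i : ℕ) :
    (List.ofFn fun k => (c k).map (X k)).flatten.count (X k i) = (c k).count i := by
  rw [List.count_flatten, List.map_ofFn, List.sum_ofFn, Finset.sum_eq_single k]
  · exact List.count_map_of_injective _ _ (hX.right k) i
  · intro l _ hl
    refine List.count_eq_zero.2 fun h => ?_
    obtain ⟨j, _, hj⟩ := List.mem_map.1 h
    exact hl (hX hj).1
  · simp

theorem count_gPart (s : PBWIndex n) (i : ℕ) : (gPart s).count (Gen.g i) = s.a.1.count i :=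
  List.count_map_of_injective _ _ (fun _ _ h => Gen.g.inj h) i

theorem count_hePart_h (s : PBWIndex n) (i : ℕ) : (hePart s).count (Gen.h i) = s.b.1.count i := by
  rw [hePart, List.count_append, List.count_map_of_injective _ _ (fun _ _ h => Gen.h.inj h),
    Nat.add_eq_left, List.count_eq_zero]
  simp [List.mem_ofFn]

theorem count_hePart_e (s : PBWIndex n) (k : Fin n) (i : ℕ) :
    (hePart s).count (Gen.e k i) = (s.c k).1.count i := by
  rw [hePart, List.count_append,
    count_flatten_ofFn (X := Gen.e) (fun _ _ _ _ h => Gen.e.inj h) (fun k => (s.c k).1),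
    Nat.add_eq_right, List.count_eq_zero]
  simp

theorem count_fPart (s : PBWIndex n) (k : Fin n) (i : ℕ) :
    (fPart s).count (Gen.f k i) = (s.d k).1.count i :=
  count_flatten_ofFn (X := Gen.f) (fun _ _ _ _ h => Gen.f.inj h) (fun k => (s.d k).1) k i

theorem count_le_one_of_pairwise {l : List ℕ} (h : l.Pairwise (· > ·)) (i : ℕ) :
    l.count i ≤ 1 :=
  List.nodup_iff_count_le_one.1 (h.imp fun h => ne_of_gt h) i

theorem gPart_count_of_ne {s : PBWIndex n} {x : Gen n} (h : ∀ i, x ≠ Gen.g i) :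
    (gPart s).count x = 0 :=
  List.count_eq_zero.2 fun hx => by
    obtain ⟨i, rfl⟩ := exists_of_mem_gPart hx
    exact h i rfl

theorem hePart_count_of_ne {s : PBWIndex n} {x : Gen n} (h : ∀ i, x ≠ Gen.h i)
    (h' : ∀ k i, x ≠ Gen.e k i) : (hePart s).count x = 0 :=
  List.count_eq_zero.2 fun hx => by
    rcases exists_of_mem_hePart hx with ⟨i, rfl⟩ | ⟨k, i, rfl⟩
    · exact h i rfl
    · exact h' k i rfl

theorem fPart_count_of_ne {s : PBWIndex n} {x : Gen n} (h : ∀ k i, x ≠ Gen.f k i) :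
    (fPart s).count x = 0 :=
  List.count_eq_zero.2 fun hx => by
    obtain ⟨k, i, rfl⟩ := exists_of_mem_fPart hx
    exact h k i rfl

theorem count_pbwWord_g (s : PBWIndex n) (i : ℕ) :
    (pbwWord s).count (Gen.g i) = s.a.1.count i := by
  simp [pbwWord, count_gPart, hePart_count_of_ne, fPart_count_of_ne]

theorem count_pbwWord_h (s : PBWIndex n) (i : ℕ) :
    (pbwWord s).count (Gen.h i) = s.b.1.count i := by
  simp [pbwWord, count_hePart_h, gPart_count_of_ne, fPart_count_of_ne]

theorem count_pbwWord_e (s : PBWIndex n) (k : Fin n) (i : ℕ) :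
    (pbwWord s).count (Gen.e k i) = (s.c k).1.count i := by
  simp [pbwWord, count_hePart_e, gPart_count_of_ne, fPart_count_of_ne]

theorem count_pbwWord_f (s : PBWIndex n) (k : Fin n) (i : ℕ) :
    (pbwWord s).count (Gen.f k i) = (s.d k).1.count i := by
  simp [pbwWord, count_fPart, gPart_count_of_ne, hePart_count_of_ne]

theorem pbwWord_perm {s t : PBWIndex n} (h : (pbwWord s).Perm (pbwWord t)) : s = t := by
  have hge : ∀ {l l' : {l : List ℕ // l.Pairwise (· ≥ ·)}},
      (∀ i, l.1.count i = l'.1.count i) → l = l' := fun {l l'} h =>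
    Subtype.ext ((List.perm_iff_count.2 h).eq_of_pairwise
      (fun _ _ _ _ h1 h2 => le_antisymm h2 h1) l.2 l'.2)
  have hgt : ∀ {l l' : {l : List ℕ // l.Pairwise (· > ·)}},
      (∀ i, l.1.count i = l'.1.count i) → l = l' := fun {l l'} h =>
    Subtype.ext ((List.perm_iff_count.2 h).eq_of_pairwise
      (fun _ _ _ _ h1 h2 => absurd h1 (lt_asymm h2)) l.2 l'.2)
  have hc := fun x => h.count_eq x
  obtain ⟨a, b, c, d⟩ := s
  obtain ⟨a', b', c', d'⟩ := t
  congr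
  · exact hge fun i => by simpa [count_pbwWord_g] using hc (Gen.g i)
  · exact hge fun i => by simpa [count_pbwWord_h] using hc (Gen.h i)
  · exact funext fun k => hgt fun i => by simpa [count_pbwWord_e] using hc (Gen.e k i)
  · exact funext fun k => hgt fun i => by simpa [count_pbwWord_f] using hc (Gen.f k i)

theorem exists_sorted_count (X : ℕ → Gen n) (hX : Function.Injective X) (l : List (Gen n)) :
    ∃ a : List ℕ, a.Pairwise (· ≥ ·) ∧ ∀ i, a.count i = l.count (X i) := by
  have h : ∃ a : List ℕ, ∀ i, a.count i = l.count (X i) := by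
    induction l with
    | nil => exact ⟨[], by simp⟩
    | cons x l ih =>
      obtain ⟨a, ha⟩ := ih
      by_cases hx : ∃ i, X i = x
      · obtain ⟨i, rfl⟩ := hx
        refine ⟨i :: a, fun j => ?_⟩
        simp [List.count_cons, ha, hX.eq_iff]
      · refine ⟨a, fun j => ?_⟩
        rw [ha, List.count_cons_of_ne fun h => hx ⟨j, h.symm⟩]
  obtain ⟨a, ha⟩ := h
  exact ⟨a.insertionSort (· ≥ ·), List.pairwise_insertionSort _ a, fun i => by
    rw [(List.perm_insertionSort (· ≥ ·) a).count_eq, ha]⟩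

theorem exists_strictly_sorted_count (X : ℕ → Gen n) (hX : Function.Injective X)
    (l : List (Gen n)) (hl : ∀ i, l.count (X i) ≤ 1) :
    ∃ a : List ℕ, a.Pairwise (· > ·) ∧ ∀ i, a.count i = l.count (X i) := by
  obtain ⟨a, ha, hc⟩ := exists_sorted_count X hX l
  refine ⟨a, ?_, hc⟩
  have hnd : a.Nodup := List.nodup_iff_count_le_one.2 fun i => (hc i).trans_le (hl i)
  exact (ha.and hnd).imp fun h => lt_of_le_of_ne h.1 h.2.symm

/-- A word in which no `e` and no `f` is repeated is a permutation of the word of an ordered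
monomial. -/
theorem exists_perm_pbwWord (l : List (Gen n)) (he : ∀ k i, l.count (Gen.e k i) ≤ 1)
    (hf : ∀ k i, l.count (Gen.f k i) ≤ 1) : ∃ s, l.Perm (pbwWord s) := by
  obtain ⟨a, ha, ha'⟩ := exists_sorted_count Gen.g (fun _ _ h => Gen.g.inj h) l
  obtain ⟨b, hb, hb'⟩ := exists_sorted_count Gen.h (fun _ _ h => Gen.h.inj h) l
  choose c hc hc' using fun k =>
    exists_strictly_sorted_count (Gen.e k) (fun _ _ h => (Gen.e.inj h).2) l (he k)
  choose d hd hd' using fun k =>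
    exists_strictly_sorted_count (Gen.f k) (fun _ _ h => (Gen.f.inj h).2) l (hf k)
  refine ⟨⟨⟨a, ha⟩, ⟨b, hb⟩, fun k => ⟨c k, hc k⟩, fun k => ⟨d k, hd k⟩⟩,
    List.perm_iff_count.2 fun x => ?_⟩
  rcases x with i | i | ⟨k, i⟩ | ⟨k, i⟩
  · rw [count_pbwWord_g, ha']
  · rw [count_pbwWord_h, hb']
  · rw [count_pbwWord_e, hc']
  · rw [count_pbwWord_f, hd']

/-- Every word is a permutation of the word of an ordered monomial, or of a word with a repeated odd
generator, when exactly the `e` and `f` are odd. -/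
theorem exists_perm_pbwWord_or {σ : Gen n → Gen n → ℚ} (he : ∀ k i, σ (.e k i) (.e k i) = -1)
    (hf : ∀ k i, σ (.f k i) (.f k i) = -1) (l : List (Gen n)) :
    (∃ s, l.Perm (pbwWord s)) ∨ ∃ i l', σ i i = -1 ∧ l.Perm (i :: i :: l') := by
  have htwo : ∀ x, ¬ l.count x ≤ 1 → ∃ l', l.Perm (x :: x :: l') := by
    intro x hx
    have h1 : x ∈ l := List.count_pos_iff.1 (by omega)
    have h2 : x ∈ l.erase x := List.count_pos_iff.1 (by rw [List.count_erase_self]; omega)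
    exact ⟨(l.erase x).erase x,
      (List.perm_cons_erase h1).trans ((List.perm_cons_erase h2).cons x)⟩
  by_cases h1 : ∀ k i, l.count (Gen.e k i) ≤ 1
  · by_cases h2 : ∀ k i, l.count (Gen.f k i) ≤ 1
    · exact Or.inl (exists_perm_pbwWord l h1 h2)
    · push Not at h2
      obtain ⟨k, i, h2⟩ := h2
      obtain ⟨l', hl'⟩ := htwo _ (not_le.2 h2)
      exact Or.inr ⟨_, l', hf k i, hl'⟩
  · push Not at h1
    obtain ⟨k, i, h1⟩ := h1
    obtain ⟨l', hl'⟩ := htwo _ (not_le.2 h1)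
    exact Or.inr ⟨_, l', he k i, hl'⟩

theorem reduced_pbwWord {σ : Gen n → Gen n → ℚ} (hg : ∀ i, σ (.g i) (.g i) ≠ -1)
    (hh : ∀ i, σ (.h i) (.h i) ≠ -1) (s : PBWIndex n) : Reduced σ (pbwWord s) := by
  rintro (i | i | ⟨k, i⟩ | ⟨k, i⟩) hi
  · exact absurd hi (hg i)
  · exact absurd hi (hh i)
  · rw [count_pbwWord_e]; exact count_le_one_of_pairwise (s.c k).2 i
  · rw [count_pbwWord_f]; exact count_le_one_of_pairwise (s.d k).2 i

end PBWWord

/-! ### Leading terms of the oscillator representation -/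

namespace ColorAlg

theorem signHom_congr {I : Type*} {σ : I → I → ℚ} {i i' : I} (h : ∀ j, σ i j = σ i' j)
    (a : ColorAlg σ) : signHom i a = signHom i' a := by
  induction a using induction with
  | one => simp
  | add a b ha hb => simp [ha, hb]
  | smul c a ha => simp [ha]
  | mul j a ha => simp [ha, h]

theorem signHom_eq_self {I : Type*} {σ : I → I → ℚ} {i : I} (h : ∀ j, σ i j = 1)
    (a : ColorAlg σ) : signHom i a = a := by
  induction a using induction with
  | one => simp
  | add a b ha hb => simp [ha, hb]
  | smul c a ha => simp [ha]
  | mul j a ha => simp [ha, h]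

end ColorAlg

open ColorAlg

/-- The index of a generator. -/
def Gen.idx {n : ℕ} : Gen n → ℕ
  | .g i => i
  | .h i => i
  | .e _ i => i
  | .f _ i => i

/-- The filtration degree of the leading term of the operator of a generator. -/
def Gen.shift {n : ℕ} : Gen n → ℤ
  | .g _ => -1
  | .h _ => 1
  | .e _ _ => 1
  | .f _ _ => -1

/-- The variable of the oscillator representation which corresponds to a generator, when `h (2 * M)`
is shifted by `1`. The leading term of the operator of the generator is the multiplication by this
variable for `h` and `e`, and the partial derivative with respect to it for `g` and `f`. For indices
less than `M` the variables are distinct, as `i < M` implies `M < 2 * M - i`. -/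
def Gen.var {n : ℕ} (M : ℕ) : Gen n → Osc n
  | .g i => .h (2 * (2 * M) + 1 - i)
  | .h i => .h i
  | .e k i => .e k i
  | .f k i => .e k (2 * M - i)

/-- A left inverse of `Gen.var M` on the generators of index less than `M`. -/
def Osc.toGen {n : ℕ} (M : ℕ) : Osc n → Gen n
  | .h j => if j ≤ 2 * M then .h j else .g (2 * (2 * M) + 1 - j)
  | .e k j => if j ≤ M then .e k j else .f k (2 * M - j)

theorem Gen.toGen_var {n M : ℕ} {x : Gen n} (hx : x.idx < M) : (x.var M).toGen M = x := by
  rcases x with i | i | ⟨k, i⟩ | ⟨k, i⟩ <;> simp only [Gen.idx] at hx <;>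
    simp only [Gen.var, Osc.toGen]
  · rw [if_neg (by omega), show 2 * (2 * M) + 1 - (2 * (2 * M) + 1 - i) = i by omega]
  · rw [if_pos (by omega)]
  · rw [if_pos (by omega)]
  · rw [if_neg (by omega), show 2 * M - (2 * M - i) = i by omega]

theorem map_toGen_map_var {n M : ℕ} {l : List (Gen n)} (hl : ∀ x ∈ l, x.idx < M) :
    (l.map (Gen.var M)).map (Osc.toGen M) = l := by
  rw [List.map_map]
  exact (List.map_congr_left fun x hx => Gen.toGen_var (hl x hx)).trans (List.map_id l)

section Lead

variable {n : ℕ} (M : ℕ)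

/-- The leading term of the operator of a generator of index less than `M`. -/
def lead : Gen n → Module.End ℚ (OscAlg n)
  | .g i => pd (isColor_oscSign n) (Gen.var M (.g i))
  | .h i => LinearMap.mulLeft ℚ (X oscSign (Gen.var M (.h i)))
  | .e k i => LinearMap.mulLeft ℚ (X oscSign (Gen.var M (.e k i)))
  | .f k i => pd (isColor_oscSign n) (Gen.var M (.f k i))

variable {M}

theorem aug_oscPoly_hBracket {i : ℕ} (hi : i < M) (j : ℕ) :
    aug oscSign (oscPoly (2 * M) n (hBracket MvPolynomial.X i j)) =
      if j = 2 * (2 * M) + 1 - i then 1 else 0 := by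
  have h1 : aug oscSign (oscPoly (2 * M) n (hBracket MvPolynomial.X i j)) =
      osum i j fun c => (if c = 2 * M then (1 : ℚ) else 0) *
        if i + j - 1 - c = 2 * M then 1 else 0 := by
    refine (map_osum (((aug oscSign).comp (oscPoly (2 * M) n) : MvPolynomial ℕ ℚ →ₐ[ℚ] ℚ) :
      MvPolynomial ℕ ℚ →+ ℚ) _ _ _).trans (osum_congr fun c _ => ?_)
    simp only [AddMonoidHom.coe_coe, AlgHom.comp_apply, map_mul, oscPoly_X, oscH, map_add, aug_X,
      zero_add]
    split_ifs <;> simp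
  rw [h1, osum]
  simp only [ite_mul, one_mul, zero_mul, Finset.sum_ite_eq', Finset.mem_range]
  rw [if_neg (show ¬ 2 * M < i by omega), sub_zero]
  split_ifs <;> first | rfl | omega

/-- A generator of small index acts by its leading term, up to terms of higher filtration. -/
theorem oscOp_sub_lead_mem_fil {x : Gen n} (hx : x.idx < M) {p : ℤ} {a : OscAlg n}
    (ha : a ∈ fil oscSign p) :
    oscOp (2 * M) x a - lead M x a ∈ fil oscSign (p + x.shift + 1) := by
  have hσ := isColor_oscSign n
  rcases x with i | i | ⟨k, i⟩ | ⟨k, i⟩ <;> simp only [Gen.idx] at hx <;>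
    simp only [oscOp, lead, Gen.shift, Gen.var]
  · have hpd : ∀ a b, pd hσ (Osc.h (2 * (2 * M) + 1 - i)) (a * b) =
        pd hσ (Osc.h (2 * (2 * M) + 1 - i)) a * b + a * pd hσ (Osc.h (2 * (2 * M) + 1 - i)) b := by
      intro a b
      rw [pd_mul, signHom_eq_self fun _ => rfl]
    have := twisted_derivation_mem_fil (σ := oscSign) (τ := fun a => a)
      (D := oscG (2 * M) i - pd hσ (Osc.h (2 * (2 * M) + 1 - i))) (fun _ _ h => h)
      (fun a b => by simp only [LinearMap.sub_apply, oscG_mul, hpd]; noncomm_ring)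
      (by simp [oscG_one, pd_one]) (q := 0) (fun j => mem_fil_one_of_aug ?_) ha
    · simpa using this
    · rw [LinearMap.sub_apply, map_sub, oscG_X, pd_X]
      rcases j with j | ⟨k, j⟩
      · rw [oscGVal, aug_oscPoly_hBracket hx]
        simp only [Osc.h.injEq]
        split_ifs <;> simp
      · simp [oscGVal]
  · rw [LinearMap.mulLeft_apply, LinearMap.mulLeft_apply, oscH, if_neg (by omega), add_zero,
      sub_self]
    exact zero_mem _
  · rw [sub_self]
    exact zero_mem _
  · have hpd : ∀ a b, pd hσ (Osc.e k (2 * M - i)) (a * b) = pd hσ (Osc.e k (2 * M - i)) a * b +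
        signHom (Osc.e k 0) a * pd hσ (Osc.e k (2 * M - i)) b := by
      intro a b
      rw [pd_mul, signHom_congr (i' := Osc.e k 0) fun j => by cases j <;> rfl]
    have := twisted_derivation_mem_fil (σ := oscSign) (τ := signHom (Osc.e k 0))
      (D := oscF (2 * M) k i - pd hσ (Osc.e k (2 * M - i))) (fun _ _ h => signHom_mem_fil _ h)
      (fun a b => by simp only [LinearMap.sub_apply, oscF_mul, hpd]; noncomm_ring)
      (by simp [oscF_one, pd_one]) (q := 0) (fun j => mem_fil_one_of_aug ?_) ha
    · simpa using this
    · rw [LinearMap.sub_apply, map_sub, oscF_X, pd_X]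
      rcases j with j | ⟨m, j⟩
      · simp [oscFVal]
      · simp only [oscFVal, Osc.e.injEq]
        by_cases hm : m = k
        · have : j + i = 2 * M ↔ j = 2 * M - i := by omega
          simp only [hm, if_true, true_and, oscH, map_add, aug_X, zero_add, this]
          split_ifs <;> simp
        · simp [hm]

theorem lead_mem_fil (x : Gen n) {p : ℤ} {a : OscAlg n} (ha : a ∈ fil oscSign p) :
    lead M x a ∈ fil oscSign (p + x.shift) := by
  rcases x with i | i | ⟨k, i⟩ | ⟨k, i⟩
  · exact pd_mem_fil (isColor_oscSign n) _ ha
  · rw [add_comm]; exact mul_mem_fil (X_mem_fil _) ha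
  · rw [add_comm]; exact mul_mem_fil (X_mem_fil _) ha
  · exact pd_mem_fil (isColor_oscSign n) _ ha

theorem prod_lead_mem_fil (l : List (Gen n)) {p : ℤ} {a : OscAlg n}
    (ha : a ∈ fil oscSign p) :
    (l.map (lead M)).prod a ∈ fil oscSign (p + (l.map Gen.shift).sum) := by
  induction l with
  | nil => simpa using ha
  | cons x l ih =>
    simp only [List.map_cons, List.prod_cons, Module.End.mul_apply, List.sum_cons]
    rw [add_left_comm, add_comm x.shift]
    exact lead_mem_fil x ih

theorem prod_oscOp_sub_prod_lead_mem_fil {l : List (Gen n)} (hl : ∀ x ∈ l, x.idx < M) {p : ℤ}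
    {a : OscAlg n} (ha : a ∈ fil oscSign p) :
    (l.map (oscOp (2 * M))).prod a - (l.map (lead M)).prod a ∈
      fil oscSign (p + (l.map Gen.shift).sum + 1) := by
  induction l with
  | nil => simp
  | cons x l ih =>
    have h1 := ih fun y hy => hl y (List.mem_cons_of_mem _ hy)
    have hx := hl x List.mem_cons_self
    have h2 := oscOp_sub_lead_mem_fil hx h1
    have h3 := lead_mem_fil (M := M) x h1
    have h4 := oscOp_sub_lead_mem_fil hx (prod_lead_mem_fil (M := M) l ha)
    simp only [List.map_cons, List.prod_cons, Module.End.mul_apply, List.sum_cons]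
    rw [map_sub] at h2
    have h5 := Submodule.add_mem (fil oscSign (p + (l.map Gen.shift).sum + 1 + x.shift))
      (Submodule.add_mem _ (fil_anti (by omega) h2) h3) (fil_anti (by omega) h4)
    rw [map_sub] at h5
    refine fil_anti (q := p + (l.map Gen.shift).sum + 1 + x.shift) (le_of_eq (by ring)) ?_
    convert h5 using 1
    abel

end Lead

/-! ### Linear independence of the ordered monomials -/

section Independent

variable {n : ℕ} (M : ℕ)

theorem reduced_map_var {l : List (Gen n)} (hl : ∀ x ∈ l, x.idx < M)
    (he : ∀ k i, l.count (Gen.e k i) ≤ 1) (hf : ∀ k i, l.count (Gen.f k i) ≤ 1) :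
    Reduced oscSign (l.map (Gen.var M)) := by
  rintro (j | ⟨k, j⟩) h
  · simp [oscSign] at h; norm_num at h
  · have h1 : (l.map (Gen.var M)).count (Osc.e k j) ≤ l.count ((Osc.e k j).toGen M) := by
      conv_rhs => rw [← map_toGen_map_var hl]
      exact List.count_le_count_map
    refine h1.trans ?_
    rw [Osc.toGen]
    split_ifs
    · exact he _ _
    · exact hf _ _

/-- The word on which the ordered monomial `s` is tested. -/
def testWord (s : PBWIndex n) : List (Osc n) := (gPart s ++ fPart s).map (Gen.var M)

/-- The functional on the oscillator representation by which the ordered monomial `s` is tested. -/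
def testForm (s : PBWIndex n) : OscAlg n →ₗ[ℚ] ℚ :=
  (aug oscSign).toLinearMap ∘ₗ
    (((hePart s).map (Gen.var M)).map (pd (isColor_oscSign n))).prod

theorem map_lead_hePart (s : PBWIndex n) (a : OscAlg n) :
    ((hePart s).map (lead M)).prod a = word oscSign ((hePart s).map (Gen.var M)) * a := by
  have key : ∀ l : List (Gen n), (∀ x ∈ l, (∃ i, x = Gen.h i) ∨ ∃ k i, x = Gen.e k i) →
      (l.map (lead M)).prod a = word oscSign (l.map (Gen.var M)) * a := by
    intro l hl
    induction l with
    | nil => simp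
    | cons x l ih =>
      have h1 := ih fun y hy => hl y (List.mem_cons_of_mem _ hy)
      rw [List.map_cons, List.prod_cons, Module.End.mul_apply, h1, List.map_cons, word_cons,
        mul_assoc]
      rcases hl x List.mem_cons_self with ⟨i, rfl⟩ | ⟨k, i, rfl⟩ <;> rfl
  exact key _ fun x hx => exists_of_mem_hePart hx

theorem map_lead_gPart (s : PBWIndex n) :
    (gPart s).map (lead M) = ((gPart s).map (Gen.var M)).map (pd (isColor_oscSign n)) := by
  rw [List.map_map]
  refine List.map_congr_left fun x hx => ?_
  obtain ⟨i, rfl⟩ := exists_of_mem_gPart hx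
  rfl

theorem map_lead_fPart (s : PBWIndex n) :
    (fPart s).map (lead M) = ((fPart s).map (Gen.var M)).map (pd (isColor_oscSign n)) := by
  rw [List.map_map]
  refine List.map_congr_left fun x hx => ?_
  obtain ⟨k, i, rfl⟩ := exists_of_mem_fPart hx
  rfl

variable {M}

/-- The leading terms of the ordered monomials are dual to the test data. -/
theorem testForm_lead_ne_zero_iff {s t : PBWIndex n} (hs : ∀ x ∈ pbwWord s, x.idx < M)
    (ht : ∀ x ∈ pbwWord t, x.idx < M) :
    testForm M s (((pbwWord t).map (lead M)).prod (word oscSign (testWord M s))) ≠ 0 ↔ t = s := by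
  have hσ := isColor_oscSign n
  have hmem : ∀ {u : PBWIndex n}, (∀ x ∈ pbwWord u, x.idx < M) →
      (∀ x ∈ gPart u, x.idx < M) ∧ (∀ x ∈ hePart u, x.idx < M) ∧ ∀ x ∈ fPart u, x.idx < M := by
    intro u hu
    refine ⟨fun x hx => hu x ?_, fun x hx => hu x ?_, fun x hx => hu x ?_⟩ <;>
      simp [pbwWord, hx]
  obtain ⟨hsg, hse, hsf⟩ := hmem hs
  obtain ⟨htg, hte, htf⟩ := hmem ht
  have hone_e : ∀ (u : PBWIndex n) k i, (hePart u).count (Gen.e k i) ≤ 1 := fun u k i => by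
    rw [count_hePart_e]; exact count_le_one_of_pairwise (u.c k).2 i
  have hone_f : ∀ (u : PBWIndex n) k i, (fPart u).count (Gen.f k i) ≤ 1 := fun u k i => by
    rw [count_fPart]; exact count_le_one_of_pairwise (u.d k).2 i
  have hB : Reduced oscSign ((hePart t ++ (gPart s ++ fPart s)).map (Gen.var M)) := by
    refine reduced_map_var M ?_ ?_ ?_
    · simp only [List.mem_append]
      rintro x (h | h | h)
      exacts [hte x h, hsg x h, hsf x h]
    · intro k i
      simpa [gPart_count_of_ne, fPart_count_of_ne] using hone_e t k i
    · intro k i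
      simpa [gPart_count_of_ne, hePart_count_of_ne] using hone_f s k i
  rw [List.map_append] at hB
  have hA : Reduced oscSign (testWord M s) := fun i hi =>
    le_trans (by rw [testWord, List.count_append]; exact Nat.le_add_left _ _) (hB i hi)
  have hB' : Reduced oscSign ((hePart t).map (Gen.var M) ++
      (testWord M s).diff ((fPart t).map (Gen.var M))) := fun i hi =>
    le_trans (by
      rw [testWord, List.count_append, List.count_append, List.count_diff]; omega) (hB i hi)
  -- the test word is hit by the `f`'s, the `h`'s and `e`'s, the `g`'s, and the test form in turn
  obtain ⟨c₁, h₁, h₁'⟩ := exists_prod_pd_word hσ ((fPart t).map (Gen.var M)) hA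
  obtain ⟨c₂, h₂, h₂'⟩ := exists_prod_pd_word hσ ((gPart t).map (Gen.var M)) hB'
  obtain ⟨c₃, h₃, h₃'⟩ := exists_prod_pd_word hσ ((hePart s).map (Gen.var M))
    (hB'.diff ((gPart t).map (Gen.var M)))
  have hval : testForm M s (((pbwWord t).map (lead M)).prod (word oscSign (testWord M s))) =
      c₁ * (c₂ * (c₃ * aug oscSign (word oscSign ((((hePart t).map (Gen.var M) ++
        (testWord M s).diff ((fPart t).map (Gen.var M))).diff ((gPart t).map (Gen.var M))).diff
          ((hePart s).map (Gen.var M)))))) := by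
    rw [pbwWord, List.map_append, List.prod_append, List.map_append, List.prod_append,
      Module.End.mul_apply, Module.End.mul_apply, map_lead_fPart, h₁, map_smul, map_smul,
      map_smul, map_lead_hePart, ← word_append, map_lead_gPart, h₂, map_smul, testForm,
      LinearMap.comp_apply, h₃]
    simp
  rw [hval]
  constructor
  · intro h
    simp only [mul_ne_zero_iff] at h
    obtain ⟨hc₁, hc₂, hc₃, h⟩ := h
    have hnil := congrArg (fun l x => List.count x l) (not_not.1 (mt aug_word h))
    -- no derivative kills the word, and all letters are used up: both words have the same letters
    have hperm : ((fPart t ++ (gPart t ++ hePart s)).map (Gen.var M)).Perm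
        ((hePart t ++ (gPart s ++ fPart s)).map (Gen.var M)) := by
      refine List.perm_iff_count.2 fun x => ?_
      have e₁ := h₁'.1 hc₁ x
      have e₂ := h₂'.1 hc₂ x
      have e₃ := h₃'.1 hc₃ x
      have e₄ := congrFun hnil x
      simp only [testWord, List.map_append, List.count_append, List.count_diff,
        List.count_nil] at e₁ e₂ e₃ e₄ ⊢
      omega
    have hperm' := hperm.map (Osc.toGen M)
    rw [map_toGen_map_var, map_toGen_map_var] at hperm'
    · refine pbwWord_perm (List.perm_iff_count.2 fun x => ?_)
      have hx := hperm'.count_eq x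
      simp only [pbwWord, List.count_append] at hx ⊢
      rcases x with i | i | ⟨k, i⟩ | ⟨k, i⟩ <;>
        simp [gPart_count_of_ne, hePart_count_of_ne, fPart_count_of_ne] at hx ⊢ <;> omega
    · simp only [List.mem_append]
      rintro x (h | h | h)
      exacts [hte x h, hsg x h, hsf x h]
    · simp only [List.mem_append]
      rintro x (h | h | h)
      exacts [htf x h, htg x h, hse x h]
  · rintro rfl
    refine mul_ne_zero (h₁'.2 fun x => ?_) (mul_ne_zero (h₂'.2 fun x => ?_)
      (mul_ne_zero (h₃'.2 fun x => ?_) ?_))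
    · simp only [testWord, List.map_append, List.count_append]; omega
    · simp only [testWord, List.map_append, List.count_append, List.count_diff]; omega
    · simp only [testWord, List.map_append, List.count_append, List.count_diff]; omega
    · rw [show ((((hePart t).map (Gen.var M) ++
        (testWord M t).diff ((fPart t).map (Gen.var M))).diff ((gPart t).map (Gen.var M))).diff
          ((hePart t).map (Gen.var M))) = [] from ?_]
      · simp
      · refine List.eq_nil_iff_forall_not_mem.2 fun x hx => ?_
        have := List.count_pos_iff.2 hx
        simp only [testWord, List.map_append, List.count_append, List.count_diff] at this
        omega

/-- The total filtration degree of the leading term of an ordered monomial. -/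
def pbwShift (s : PBWIndex n) : ℤ := ((pbwWord s).map Gen.shift).sum

theorem pbwShift_eq (M : ℕ) (s : PBWIndex n) :
    pbwShift s + (testWord M s).length = (hePart s).length := by
  have hg : ((gPart s).map Gen.shift).sum = -(gPart s).length := by
    rw [List.map_congr_left (g := fun _ => -1) fun x hx => by
      obtain ⟨i, rfl⟩ := exists_of_mem_gPart hx; rfl]
    simp
  have hf : ((fPart s).map Gen.shift).sum = -(fPart s).length := by
    rw [List.map_congr_left (g := fun _ => -1) fun x hx => by
      obtain ⟨k, i, rfl⟩ := exists_of_mem_fPart hx; rfl]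
    simp
  have hh : ((hePart s).map Gen.shift).sum = (hePart s).length := by
    rw [List.map_congr_left (g := fun _ => 1) fun x hx => by
      rcases exists_of_mem_hePart hx with ⟨i, rfl⟩ | ⟨k, i, rfl⟩ <;> rfl]
    simp
  simp only [pbwShift, pbwWord, testWord, List.map_append, List.sum_append, hg, hf, hh,
    List.length_append, List.length_map]
  push_cast
  ring

theorem linearIndependent_pbwMonomial (n : ℕ) :
    LinearIndependent ℚ (pbwMonomial : PBWIndex n → P n) := by
  rw [linearIndependent_iff']
  intro T c hc
  by_contra! hne
  -- a term with nonzero coefficient whose leading term has the least filtration degree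
  obtain ⟨s, hs, hmin⟩ := Finset.exists_min_image (T.filter fun s => c s ≠ 0) pbwShift (by
    obtain ⟨s, hs, hcs⟩ := hne
    exact ⟨s, Finset.mem_filter.2 ⟨hs, hcs⟩⟩)
  obtain ⟨hsT, hcs⟩ := Finset.mem_filter.1 hs
  obtain ⟨M, hM⟩ : ∃ M, ∀ t ∈ T, ∀ x ∈ pbwWord t, x.idx < M := by
    refine ⟨(∑ t ∈ T, ((pbwWord t).map Gen.idx).sum) + 1, fun t ht x hx => ?_⟩
    have h1 := List.single_le_sum (fun _ _ => Nat.zero_le _) _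
      (List.mem_map_of_mem (f := Gen.idx) hx)
    have h2 := Finset.single_le_sum (f := fun t => ((pbwWord t).map Gen.idx).sum)
      (fun _ _ => Nat.zero_le _) ht
    omega
  have hrep : ∀ t : PBWIndex n,
      oscRep (2 * M) (pbwMonomial t) = ((pbwWord t).map (oscOp (2 * M))).prod := by
    intro t
    rw [pbwMonomial_eq, map_list_prod, List.map_map]
    congr 1
    exact List.map_congr_left fun x _ => oscRep_gen _ x
  have h0 := congrArg (fun X => testForm M s (oscRep (2 * M) X (word oscSign (testWord M s)))) hc
  simp only [map_sum, map_smul, LinearMap.sum_apply, LinearMap.smul_apply, map_zero,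
    LinearMap.zero_apply, hrep] at h0
  -- by minimality of the shift, the test form kills all terms but the leading ones
  have hlead : ∀ t ∈ T, c t ≠ 0 →
      testForm M s (((pbwWord t).map (oscOp (2 * M))).prod (word oscSign (testWord M s))) =
        testForm M s (((pbwWord t).map (lead M)).prod (word oscSign (testWord M s))) := by
    intro t ht hct
    rw [← sub_eq_zero, ← map_sub]
    have h1 := prod_oscOp_sub_prod_lead_mem_fil (hM t ht)
      (word_mem_fil (σ := oscSign) (l := testWord M s) le_rfl)
    have h2 := prod_pd_mem_fil (isColor_oscSign n) ((hePart s).map (Gen.var M)) h1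
    refine aug_of_mem_fil (fil_anti ?_ h2)
    have h3 := hmin t (Finset.mem_filter.2 ⟨ht, hct⟩)
    have h4 := pbwShift_eq M s
    rw [List.length_map]
    simp only [pbwShift] at h3 h4 ⊢
    omega
  rw [Finset.sum_eq_single_of_mem s hsT] at h0
  · rw [hlead s hsT hcs] at h0
    rcases smul_eq_zero.1 h0 with h0 | h0
    · exact hcs h0
    · exact (testForm_lead_ne_zero_iff (hM s hsT) (hM s hsT)).2 rfl h0
  · intro t ht hts
    by_cases hct : c t = 0
    · rw [hct, zero_smul]
    · rw [hlead t ht hct]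
      have := mt (testForm_lead_ne_zero_iff (hM s hsT) (hM t ht)).1 hts
      rw [not_not.1 this, smul_zero]

end Independent

/-! ### The basis of ordered monomials -/

/-- Normal words form a basis if they are linearly independent and span the words degree by
degree. -/
theorem exists_basis_of_wordSpan_le {A I Γ S : Type*} [Ring A] [Algebra ℚ A] [AddCommMonoid Γ]
    {x : I → A} {deg : I → Γ} {L : S → List I} (hx : Algebra.adjoin ℚ (Set.range x) = ⊤)
    (hli : LinearIndependent ℚ fun s => ((L s).map x).prod)
    (hspan : ∀ γ, wordSpan x deg γ ≤
      Submodule.span ℚ {a | ∃ s, ((L s).map deg).sum = γ ∧ a = ((L s).map x).prod}) :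
    ∃ b : Module.Basis S ℚ A, ∀ s, b s = ((L s).map x).prod := by
  refine ⟨Module.Basis.mk hli ?_, fun s => Module.Basis.mk_apply _ _ s⟩
  rw [← Algebra.top_toSubmodule, ← hx, Algebra.adjoin_eq_span, Submodule.span_le]
  intro a ha
  obtain ⟨l, hl, rfl⟩ := Submonoid.exists_list_of_mem_closure ha
  obtain ⟨l', rfl⟩ : l ∈ Set.range (List.map x) := by rw [Set.range_list_map]; exact hl
  refine Submodule.span_mono ?_ (hspan _ (prod_mem_wordSpan l'))
  rintro _ ⟨s, _, rfl⟩
  exact ⟨s, rfl⟩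

section Spanning

variable {n : ℕ}

/-- The signs up to which the generators commute modulo terms of lower weight. -/
def genSign : Gen n → Gen n → ℚ
  | .e k _, .e l _ => if k = l then -1 else 1
  | .e k _, .f l _ => if k = l then -1 else 1
  | .f k _, .e l _ => if k = l then -1 else 1
  | .f k _, .f l _ => if k = l then -1 else 1
  | _, _ => 1

/-- Weights of the generators for which the right hand sides of the relations are of lower weight
than the products on the left. -/
def Gen.weight : Gen n → ℕ
  | .g _ => 2
  | _ => 1

theorem genSign_symm (x y : Gen n) : genSign x y = genSign y x := by
  rcases x with i | i | ⟨k, i⟩ | ⟨k, i⟩ <;> rcases y with j | j | ⟨l, j⟩ | ⟨l, j⟩ <;>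
    simp [genSign, eq_comm]

theorem genSign_sq (x y : Gen n) : genSign x y * genSign x y = 1 := by
  rcases x with i | i | ⟨k, i⟩ | ⟨k, i⟩ <;> rcases y with j | j | ⟨l, j⟩ | ⟨l, j⟩ <;>
    simp only [genSign, mul_one] <;> split_ifs <;> norm_num

/-- The span of the words which are lower than the product of two generators and of the same
degree. -/
abbrev lowerTerms (x y : Gen n) : Submodule ℚ (P n) :=
  lowSpan gen Gen.deg Gen.weight (x.weight + y.weight) (x.deg + y.deg)

theorem lowerTerms_congr {x y x' y' : Gen n} (hw : x.weight + y.weight = x'.weight + y'.weight)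
    (hd : x.deg + y.deg = x'.deg + y'.deg) : lowerTerms x y = lowerTerms x' y' := by
  rw [lowerTerms, hw, hd]

theorem mul_mem_lowerTerms {x y x' y' : Gen n} (hw : x'.weight + y'.weight < x.weight + y.weight)
    (hd : x'.deg + y'.deg = x.deg + y.deg) : gen x' * gen y' ∈ lowerTerms x y := by
  simpa using prod_mem_lowSpan (x := gen) (deg := Gen.deg) (w := Gen.weight) (l := [x', y'])
    (by simpa using hw) (by simpa using hd)

theorem genSign_rel_symm {x y : Gen n}
    (h : colorComm (genSign x y) (gen x) (gen y) ∈ lowerTerms x y) :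
    colorComm (genSign y x) (gen y) (gen x) ∈ lowerTerms y x := by
  rw [genSign_symm y x, colorComm_swap (genSign_sq x y), lowerTerms_congr (add_comm _ _)
    (add_comm _ _)]
  exact Submodule.smul_mem _ _ h

theorem dimE_add_dimF (k : Fin n) : dimE k + dimF k = delta n := by
  refine Subtype.ext (funext fun v => ?_)
  rcases v with _ | l | _ <;> simp [dimE, dimF, delta]
  split_ifs <;> rfl

theorem gen_e_mul_e (k : Fin n) (i j : ℕ) :
    gen (.e k i) * gen (.e k j) = -(gen (.e k j) * gen (.e k i)) := by
  rw [← sub_eq_zero, sub_neg_eq_add]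
  simpa [anticomm, E, gen] using RingQuot.mkAlgHom_rel ℚ (Rel.ee k i j)

theorem gen_f_mul_f (k : Fin n) (i j : ℕ) :
    gen (.f k i) * gen (.f k j) = -(gen (.f k j) * gen (.f k i)) := by
  rw [← sub_eq_zero, sub_neg_eq_add]
  simpa [anticomm, F, gen] using RingQuot.mkAlgHom_rel ℚ (Rel.ff k i j)

theorem gen_e_mul_f (k : Fin n) (i j : ℕ) :
    gen (.e k i) * gen (.f k j) + gen (.f k j) * gen (.e k i) = gen (.h (i + j)) := by
  simpa [anticomm, E, F, H, gen] using RingQuot.mkAlgHom_rel ℚ (Rel.ef k i j)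

theorem gen_e_mul_e_of_ne {k l : Fin n} (hkl : k ≠ l) (i j : ℕ) :
    gen (.e k i) * gen (.e l j) = gen (.e l j) * gen (.e k i) := by
  rw [← sub_eq_zero]
  simpa [comm, E, gen] using RingQuot.mkAlgHom_rel ℚ (Rel.ee_ne k l hkl i j)

theorem gen_f_mul_f_of_ne {k l : Fin n} (hkl : k ≠ l) (i j : ℕ) :
    gen (.f k i) * gen (.f l j) = gen (.f l j) * gen (.f k i) := by
  rw [← sub_eq_zero]
  simpa [comm, F, gen] using RingQuot.mkAlgHom_rel ℚ (Rel.ff_ne k l hkl i j)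

theorem gen_e_mul_f_of_ne {k l : Fin n} (hkl : k ≠ l) (i j : ℕ) :
    gen (.e k i) * gen (.f l j) = gen (.f l j) * gen (.e k i) := by
  rw [← sub_eq_zero]
  simpa [comm, E, F, gen] using RingQuot.mkAlgHom_rel ℚ (Rel.ef_ne k l hkl i j)

theorem gen_h_mul_e (k : Fin n) (i j : ℕ) :
    gen (.h i) * gen (.e k j) = gen (.e k j) * gen (.h i) := by
  rw [← sub_eq_zero]
  simpa [comm, E, H, gen] using RingQuot.mkAlgHom_rel ℚ (Rel.he k i j)

theorem gen_h_mul_f (k : Fin n) (i j : ℕ) :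
    gen (.h i) * gen (.f k j) = gen (.f k j) * gen (.h i) := by
  rw [← sub_eq_zero]
  simpa [comm, F, H, gen] using RingQuot.mkAlgHom_rel ℚ (Rel.hf k i j)

theorem gen_h_mul_h (i j : ℕ) :
    (gen (.h i) * gen (.h j) : P n) = gen (.h j) * gen (.h i) := by
  rw [← sub_eq_zero]
  simpa [comm, H, gen] using RingQuot.mkAlgHom_rel ℚ (Rel.hh (n := n) i j)

theorem gen_g_e (k : Fin n) (i j : ℕ) :
    gen (.g i) * gen (.e k j) - gen (.e k j) * gen (.g i) =
      ∑ r ∈ Finset.range j, gen (.h (i + (j - 1 - r))) * gen (.e k r) := by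
  simpa [comm, G, H, E, gen] using RingQuot.mkAlgHom_rel ℚ (Rel.ge k i j)

theorem gen_g_f_anti (k : Fin n) (i j : ℕ) :
    gen (.g i) * gen (.f k j) - gen (.f k j) * gen (.g i) =
      -(gen (.g j) * gen (.f k i) - gen (.f k i) * gen (.g j)) := by
  have := RingQuot.mkAlgHom_rel ℚ (Rel.gf_anti k i j)
  simpa only [comm, G, F, gen, map_sub, map_mul, map_neg] using this

theorem gen_g_f (k : Fin n) {i j : ℕ} (hij : i ≤ j) :
    gen (.g i) * gen (.f k j) - gen (.f k j) * gen (.g i) =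
      ∑ r ∈ Finset.range (j - i), gen (.f k (j - 1 - r)) * gen (.h (r + i)) := by
  simpa [comm, G, H, F, gen] using RingQuot.mkAlgHom_rel ℚ (Rel.gf k i j hij)

theorem gen_g_h_anti (i j : ℕ) :
    (gen (.g i) * gen (.h j) - gen (.h j) * gen (.g i) : P n) =
      -(gen (.g j) * gen (.h i) - gen (.h i) * gen (.g j)) := by
  have := RingQuot.mkAlgHom_rel ℚ (Rel.gh_anti (n := n) i j)
  simpa only [comm, G, H, gen, map_sub, map_mul, map_neg] using this

theorem gen_g_h {i j : ℕ} (hij : i ≤ j) :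
    (gen (.g i) * gen (.h j) - gen (.h j) * gen (.g i) : P n) =
      ∑ r ∈ Finset.range (j - i), gen (.h (j - 1 - r)) * gen (.h (r + i)) := by
  simpa [comm, G, H, gen] using RingQuot.mkAlgHom_rel ℚ (Rel.gh (n := n) i j hij)

theorem gen_g_g {i j : ℕ} (hij : i ≤ j) :
    (gen (.g i) * gen (.g j) - gen (.g j) * gen (.g i) : P n) =
      2 * ∑ r ∈ Finset.range (j - i), gen (.g (j - 1 - r)) * gen (.h (r + i)) := by
  simpa [comm, G, H, gen, two_mul] using RingQuot.mkAlgHom_rel ℚ (Rel.gg (n := n) i j hij)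

theorem gen_g_f_mem (k : Fin n) (i j : ℕ) :
    gen (.g i) * gen (.f k j) - gen (.f k j) * gen (.g i) ∈ lowerTerms (.g i) (.f k j) := by
  have key : ∀ {i j : ℕ}, i ≤ j → gen (.g i) * gen (.f k j) - gen (.f k j) * gen (.g i) ∈
      lowerTerms (.g i) (.f k j) := by
    intro i j hij
    rw [gen_g_f k hij]
    refine Submodule.sum_mem _ fun r hr => mul_mem_lowerTerms (by simp [Gen.weight]) ?_
    have := Finset.mem_range.1 hr
    exact Prod.ext (by simp only [Gen.deg, Prod.fst_add]; omega) (add_comm _ _)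
  rcases le_total i j with h | h
  · exact key h
  · have hdeg : (Gen.g i).deg + (Gen.f k j).deg = (Gen.g j).deg + (Gen.f k i).deg :=
      Prod.ext (by simp only [Gen.deg, Prod.fst_add]; ring) rfl
    rw [gen_g_f_anti, lowerTerms_congr (x := .g i) (y := .f k j) (x' := .g j)
      (y' := .f k i) rfl hdeg]
    exact neg_mem (key h)

theorem gen_g_h_mem (i j : ℕ) :
    (gen (.g i) * gen (.h j) - gen (.h j) * gen (.g i) : P n) ∈ lowerTerms (.g i) (.h j) := by
  have key : ∀ {i j : ℕ}, i ≤ j → (gen (.g i) * gen (.h j) - gen (.h j) * gen (.g i) : P n) ∈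
      lowerTerms (.g i) (.h j) := by
    intro i j hij
    rw [gen_g_h hij]
    refine Submodule.sum_mem _ fun r hr => mul_mem_lowerTerms (by simp [Gen.weight]) ?_
    have := Finset.mem_range.1 hr
    exact Prod.ext (by simp only [Gen.deg, Prod.fst_add]; omega) (add_comm _ _)
  rcases le_total i j with h | h
  · exact key h
  · have hdeg : (Gen.g (n := n) i).deg + (Gen.h j).deg = (Gen.g j).deg + (Gen.h i).deg :=
      Prod.ext (by simp only [Gen.deg, Prod.fst_add]; ring) rfl
    rw [gen_g_h_anti, lowerTerms_congr (x := .g i) (y := .h j) (x' := .g j)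
      (y' := .h i) rfl hdeg]
    exact neg_mem (key h)

theorem gen_g_g_mem {i j : ℕ} (hij : i ≤ j) :
    (gen (.g i) * gen (.g j) - gen (.g j) * gen (.g i) : P n) ∈ lowerTerms (.g i) (.g j) := by
  rw [gen_g_g hij, two_mul]
  have : (∑ r ∈ Finset.range (j - i), gen (.g (j - 1 - r)) * gen (.h (r + i)) : P n) ∈
      lowerTerms (.g i) (.g j) := by
    refine Submodule.sum_mem _ fun r hr => mul_mem_lowerTerms (by simp [Gen.weight]) ?_
    have := Finset.mem_range.1 hr
    exact Prod.ext (by simp only [Gen.deg, Prod.fst_add]; omega) (add_comm _ _)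
  exact add_mem this this

theorem gen_g_e_mem (k : Fin n) (i j : ℕ) :
    gen (.g i) * gen (.e k j) - gen (.e k j) * gen (.g i) ∈ lowerTerms (.g i) (.e k j) := by
  rw [gen_g_e]
  refine Submodule.sum_mem _ fun r hr => mul_mem_lowerTerms (by simp [Gen.weight]) ?_
  have := Finset.mem_range.1 hr
  exact Prod.ext (by simp only [Gen.deg, Prod.fst_add]; omega) rfl

theorem gen_e_f_mem (k l : Fin n) (i j : ℕ) :
    colorComm (genSign (.e k i) (.f l j)) (gen (.e k i)) (gen (.f l j)) ∈
      lowerTerms (.e k i) (.f l j) := by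
  by_cases h : k = l
  · subst h
    rw [genSign, if_pos rfl, colorComm_neg_one, gen_e_mul_f]
    have := prod_mem_lowSpan (x := gen) (deg := Gen.deg) (w := Gen.weight) (l := [.h (i + j)])
      (d := (Gen.e k i).weight + (Gen.f k j).weight)
      (γ := (Gen.e k i).deg + (Gen.f k j).deg) (by simp [Gen.weight]) (by
        rw [List.map_singleton, List.sum_singleton]
        exact Prod.ext (by simp only [Gen.deg, Prod.fst_add]; push_cast; ring)
          (dimE_add_dimF k).symm)
    simpa using this
  · rw [genSign, if_neg h, colorComm_one, gen_e_mul_f_of_ne h, sub_self]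
    exact zero_mem _

/-- The generators commute up to signs and lower terms. -/
theorem gen_mul_gen_sub_mem (x y : Gen n) :
    colorComm (genSign x y) (gen x) (gen y) ∈ lowerTerms x y := by
  rcases x with i | i | ⟨k, i⟩ | ⟨k, i⟩ <;> rcases y with j | j | ⟨l, j⟩ | ⟨l, j⟩
  · rcases le_total i j with h | h
    · simpa [genSign, colorComm_one] using gen_g_g_mem h
    · exact genSign_rel_symm (by simpa [genSign, colorComm_one] using gen_g_g_mem h)
  · simpa [genSign, colorComm_one] using gen_g_h_mem i j
  · simpa [genSign, colorComm_one] using gen_g_e_mem l i j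
  · simpa [genSign, colorComm_one] using gen_g_f_mem l i j
  · exact genSign_rel_symm (by simpa [genSign, colorComm_one] using gen_g_h_mem j i)
  · simp [genSign, colorComm_one, gen_h_mul_h i j]
  · simp [genSign, colorComm_one, gen_h_mul_e l i j]
  · simp [genSign, colorComm_one, gen_h_mul_f l i j]
  · exact genSign_rel_symm (by simpa [genSign, colorComm_one] using gen_g_e_mem k j i)
  · simp [genSign, colorComm_one, gen_h_mul_e k j i]
  · by_cases h : k = l
    · subst h; simp [genSign, colorComm_neg_one, gen_e_mul_e k i j]
    · simp [genSign, colorComm_one, h, gen_e_mul_e_of_ne h]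
  · exact gen_e_f_mem k l i j
  · exact genSign_rel_symm (by simpa [genSign, colorComm_one] using gen_g_f_mem k j i)
  · simp [genSign, colorComm_one, gen_h_mul_f k j i]
  · exact genSign_rel_symm (gen_e_f_mem l k j i)
  · by_cases h : k = l
    · subst h; simp [genSign, colorComm_neg_one, gen_f_mul_f k i j]
    · simp [genSign, colorComm_one, h, gen_f_mul_f_of_ne h]

theorem wordSpan_gen_le (γ : Bideg n) : wordSpan gen Gen.deg γ ≤
    Submodule.span ℚ {a | ∃ s, ((pbwWord s).map Gen.deg).sum = γ ∧
      a = ((pbwWord s).map (gen (n := n))).prod} :=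
  wordSpan_le_of_perm gen_mul_gen_sub_mem pbwWord
    (exists_perm_pbwWord_or (fun k i => by simp [genSign]) fun k i => by simp [genSign]) γ

theorem adjoin_range_gen : Algebra.adjoin ℚ (Set.range (gen (n := n))) = ⊤ := by
  have h1 : Set.range (gen (n := n)) =
      RingQuot.mkAlgHom ℚ (Rel n) '' Set.range (FreeAlgebra.ι ℚ) := by
    rw [← Set.range_comp]; rfl
  rw [h1, ← AlgHom.map_adjoin, FreeAlgebra.adjoin_range_ι, Algebra.map_top]
  exact (AlgHom.range_eq_top _).2 (RingQuot.mkAlgHom_surjective ℚ _)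

end Spanning

/-! ### The free supercommutative algebra -/

section Super

variable {n : ℕ}

/-- The vector of `V ⊗ ℚ[z]` which corresponds to a generator. -/
def Gen.vec : Gen n → V n ⊗[ℚ] ℚ[X]
  | .g i => Finsupp.single Summand.delta0 (1 : ℚ) ⊗ₜ[ℚ] (Polynomial.X ^ i : ℚ[X])
  | .h i => Finsupp.single Summand.delta2 (1 : ℚ) ⊗ₜ[ℚ] (Polynomial.X ^ i : ℚ[X])
  | .e k i => Finsupp.single (Summand.e k) (1 : ℚ) ⊗ₜ[ℚ] (Polynomial.X ^ i : ℚ[X])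
  | .f k i => Finsupp.single (Summand.f k) (1 : ℚ) ⊗ₜ[ℚ] (Polynomial.X ^ i : ℚ[X])

/-- The generator which corresponds to the product of a basis vector of `V` and `z ^ i`. -/
def Summand.toGen : Summand n → ℕ → Gen n
  | .e k, i => .e k i
  | .f k, i => .f k i
  | .delta0, i => .g i
  | .delta2, i => .h i

theorem Summand.vec_toGen (s : Summand n) (i : ℕ) :
    (s.toGen i).vec = Finsupp.single s (1 : ℚ) ⊗ₜ[ℚ] (Polynomial.X ^ i : ℚ[X]) := by cases s <;> rfl

theorem Summand.deg_toGen (s : Summand n) (i : ℕ) :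
    (s.toGen i).deg = s.deg + (2 * (i : ℤ), (0 : Lam n)) := by
  cases s <;> refine Prod.ext ?_ (add_zero _).symm <;>
    simp [Summand.toGen, Gen.deg, Summand.deg, add_comm]

theorem Gen.exists_toGen (x : Gen n) : ∃ s i, Summand.toGen s i = x := by
  rcases x with i | i | ⟨k, i⟩ | ⟨k, i⟩
  exacts [⟨.delta0, i, rfl⟩, ⟨.delta2, i, rfl⟩, ⟨.e k, i, rfl⟩, ⟨.f k, i, rfl⟩]

theorem Gen.vec_mem (x : Gen n) : x.vec ∈ VZ.piece n x.deg := by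
  obtain ⟨s, i, rfl⟩ := x.exists_toGen
  rw [Summand.vec_toGen, Summand.deg_toGen]
  exact Submodule.subset_span ⟨s.deg, _, _, _, Submodule.subset_span ⟨s, rfl, rfl⟩,
    Submodule.subset_span ⟨i, rfl, rfl⟩, rfl, rfl⟩

theorem VZ.piece_le (γ : Bideg n) :
    VZ.piece n γ ≤ Submodule.span ℚ {v | ∃ x : Gen n, x.deg = γ ∧ v = x.vec} := by
  refine Submodule.span_le.2 ?_
  rintro _ ⟨α, β, w, u, hw, hu, rfl, rfl⟩
  rw [SetLike.mem_coe]
  induction hw using Submodule.span_induction with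
  | mem w hw =>
    obtain ⟨s, rfl, rfl⟩ := hw
    induction hu using Submodule.span_induction with
    | mem u hu =>
      obtain ⟨i, rfl, rfl⟩ := hu
      exact Submodule.subset_span ⟨s.toGen i, s.deg_toGen i, (s.vec_toGen i).symm⟩
    | zero => simp
    | add a b _ _ ha hb => rw [TensorProduct.tmul_add]; exact add_mem ha hb
    | smul c a _ ha => rw [TensorProduct.tmul_smul]; exact Submodule.smul_mem _ c ha
  | zero => simp
  | add a b _ _ ha hb => rw [TensorProduct.add_tmul]; exact add_mem ha hb
  | smul c a _ ha => rw [← TensorProduct.smul_tmul']; exact Submodule.smul_mem _ c ha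

/-- The basis of `V ⊗ ℚ[z]` formed by the vectors of the generators. -/
def vzBasis (n : ℕ) : Module.Basis (Summand n × ℕ) ℚ (V n ⊗[ℚ] ℚ[X]) :=
  Finsupp.basisSingleOne.tensorProduct (Polynomial.basisMonomials ℚ)

theorem vzBasis_apply (s : Summand n) (i : ℕ) : vzBasis n (s, i) = (s.toGen i).vec := by
  rw [Summand.vec_toGen, vzBasis, Module.Basis.tensorProduct_apply, Finsupp.coe_basisSingleOne,
    Polynomial.coe_basisMonomials]
  exact congrArg _ (Polynomial.monomial_one_right_eq_X_pow i)

/-- The sign `(-1)^{|x||y|}` of two generators. -/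
def superSign (x y : Gen n) : ℚ := ((Int.negOnePow (x.deg.1 * y.deg.1) : ℤ) : ℚ)

theorem isColor_superSign : IsColor (superSign (n := n)) where
  symm x y := by rw [superSign, superSign, mul_comm]
  sq x y := by
    rw [superSign, ← Int.cast_mul, ← Units.val_mul, Int.units_mul_self]; simp
  odd_or_central x := by
    rcases Int.even_or_odd x.deg.1 with h | h
    · exact Or.inr fun y => by rw [superSign, Int.negOnePow_even _ (h.mul_right _)]; simp
    · exact Or.inl (by rw [superSign, Int.negOnePow_odd _ (h.mul h)]; simp)

theorem superSign_g (i : ℕ) : superSign (n := n) (.g i) (.g i) = 1 := by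
  rw [superSign, Int.negOnePow_even]
  · simp
  · exact ((even_two_mul (i : ℤ)).mul_right _)

theorem superSign_h (i : ℕ) : superSign (n := n) (.h i) (.h i) = 1 := by
  rw [superSign, Int.negOnePow_even]
  · simp
  · exact (((even_two_mul (i : ℤ)).add even_two).mul_right _)

theorem superSign_e (k : Fin n) (i : ℕ) : superSign (.e k i) (.e k i) = -1 := by
  rw [superSign, Int.negOnePow_odd]
  · simp
  · exact (odd_two_mul_add_one (i : ℤ)).mul (odd_two_mul_add_one (i : ℤ))

theorem superSign_f (k : Fin n) (i : ℕ) : superSign (.f k i) (.f k i) = -1 := by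
  rw [superSign, Int.negOnePow_odd]
  · simp
  · exact (odd_two_mul_add_one (i : ℤ)).mul (odd_two_mul_add_one (i : ℤ))

theorem negOnePow_smul {M : Type*} [AddCommGroup M] [Module ℚ M] (m : ℤ) (a : M) :
    Int.negOnePow m • a = ((Int.negOnePow m : ℤ) : ℚ) • a := by
  rw [Units.smul_def, Int.cast_smul_eq_zsmul]

/-- The generators of the free supercommutative algebra. -/
def symGen (x : Gen n) : SuperSym (VZ.piece n) := SuperSym.ι (VZ.piece n) x.vec

theorem symGen_mul_symGen (x y : Gen n) :
    symGen x * symGen y = superSign x y • (symGen y * symGen x) := by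
  have h := RingQuot.mkAlgHom_rel ℚ (SuperSymRel.swap _ _ _ _ x.vec_mem y.vec_mem)
  rw [negOnePow_smul, map_smul, map_mul, map_mul] at h
  exact h

/-- The linear map which maps the vector of each generator to a generator of the
colour-commutative algebra. -/
def vzToColor (n : ℕ) : V n ⊗[ℚ] ℚ[X] →ₗ[ℚ] ColorAlg (superSign (n := n)) :=
  (vzBasis n).constr ℚ fun p => ColorAlg.X superSign (p.1.toGen p.2)

theorem vzToColor_vec (x : Gen n) : vzToColor n x.vec = ColorAlg.X superSign x := by
  obtain ⟨s, i, rfl⟩ := x.exists_toGen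
  rw [← vzBasis_apply]
  exact (vzBasis n).constr_basis ℚ _ (s, i)

theorem vzToColor_mul {α β : Bideg n} {v w : V n ⊗[ℚ] ℚ[X]} (hv : v ∈ VZ.piece n α)
    (hw : w ∈ VZ.piece n β) : vzToColor n v * vzToColor n w =
      Int.negOnePow (α.1 * β.1) • (vzToColor n w * vzToColor n v) := by
  rw [negOnePow_smul]
  replace hv := VZ.piece_le _ hv
  replace hw := VZ.piece_le _ hw
  induction hv using Submodule.span_induction with
  | mem v hv =>
    obtain ⟨x, rfl, rfl⟩ := hv
    induction hw using Submodule.span_induction with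
    | mem w hw =>
      obtain ⟨y, rfl, rfl⟩ := hw
      rw [vzToColor_vec, vzToColor_vec, ColorAlg.X_mul_X, superSign]
    | zero => simp
    | add a b _ _ ha hb => rw [map_add, mul_add, add_mul, ha, hb, smul_add]
    | smul c a _ ha => rw [map_smul, mul_smul_comm, smul_mul_assoc, ha, smul_comm]
  | zero => simp
  | add a b _ _ ha hb => rw [map_add, mul_add, add_mul, ha, hb, smul_add]
  | smul c a _ ha => rw [map_smul, mul_smul_comm, smul_mul_assoc, ha, smul_comm]

/-- The homomorphism from the free supercommutative algebra to the colour-commutative algebra with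
the same generators. -/
def symToColor (n : ℕ) : SuperSym (VZ.piece n) →ₐ[ℚ] ColorAlg (superSign (n := n)) :=
  RingQuot.liftAlgHom ℚ ⟨TensorAlgebra.lift ℚ (vzToColor n), by
    rintro _ _ ⟨α, β, v, w, hv, hw⟩
    rw [negOnePow_smul, map_smul, ← negOnePow_smul]
    simpa using vzToColor_mul hv hw⟩

theorem symToColor_symGen (x : Gen n) : symToColor n (symGen x) = ColorAlg.X superSign x := by
  refine (RingQuot.liftAlgHom_mkAlgHom_apply _ _ _ _).trans ?_
  rw [TensorAlgebra.lift_ι_apply, vzToColor_vec]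

theorem linearIndependent_symGen :
    LinearIndependent ℚ fun s : PBWIndex n => ((pbwWord s).map symGen).prod := by
  refine LinearIndependent.of_comp (symToColor n).toLinearMap ?_
  have h1 : ((symToColor n).toLinearMap ∘ fun s : PBWIndex n => ((pbwWord s).map symGen).prod) =
      fun s => ColorAlg.word superSign (pbwWord s) := by
    funext s
    simp only [Function.comp_apply, AlgHom.toLinearMap_apply, map_list_prod, List.map_map]
    exact congrArg List.prod (List.map_congr_left fun x _ => symToColor_symGen x)
  rw [h1]
  exact ColorAlg.linearIndependent_word isColor_superSign pbwWord
    (reduced_pbwWord (fun i => by rw [superSign_g]; norm_num)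
      fun i => by rw [superSign_h]; norm_num) fun s t => pbwWord_perm

theorem wordSpan_symGen_le (γ : Bideg n) : wordSpan symGen Gen.deg γ ≤
    Submodule.span ℚ {a | ∃ s, ((pbwWord s).map Gen.deg).sum = γ ∧
      a = ((pbwWord s).map (symGen (n := n))).prod} :=
  wordSpan_le_of_perm (w := fun _ => 1)
    (fun x y => by rw [colorComm, symGen_mul_symGen, sub_self]; exact zero_mem _) pbwWord
    (exists_perm_pbwWord_or superSign_e superSign_f) γ

theorem ι_mem_wordSpan {γ : Bideg n} {v : V n ⊗[ℚ] ℚ[X]} (hv : v ∈ VZ.piece n γ) :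
    SuperSym.ι (VZ.piece n) v ∈ wordSpan symGen Gen.deg γ := by
  replace hv := VZ.piece_le _ hv
  induction hv using Submodule.span_induction with
  | mem v hv =>
    obtain ⟨x, rfl, rfl⟩ := hv
    simpa [symGen] using prod_mem_wordSpan (x := symGen) (deg := Gen.deg) [x]
  | zero => simp
  | add a b _ _ ha hb => rw [map_add]; exact add_mem ha hb
  | smul c a _ ha => rw [map_smul]; exact Submodule.smul_mem _ c ha

theorem superSymPiece_eq_wordSpan :
    SuperSym.piece (VZ.piece n) = wordSpan symGen Gen.deg := by
  funext γ
  refine le_antisymm (Submodule.span_le.2 ?_) (Submodule.span_le.2 ?_)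
  · rintro _ ⟨l, hl, rfl, rfl⟩
    rw [SetLike.mem_coe]
    induction l with
    | nil => exact Submodule.subset_span ⟨[], rfl, rfl⟩
    | cons p l ih =>
      simp only [List.map_cons, List.prod_cons, List.sum_cons]
      exact mul_mem_wordSpan (ι_mem_wordSpan (hl p List.mem_cons_self))
        (ih fun q hq => hl q (List.mem_cons_of_mem _ hq))
  · rintro _ ⟨l, rfl, rfl⟩
    refine Submodule.subset_span ⟨l.map fun x => (x.deg, x.vec), ?_, ?_, ?_⟩
    · intro p hp
      obtain ⟨x, _, rfl⟩ := List.mem_map.1 hp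
      exact x.vec_mem
    · rw [List.map_map]; rfl
    · rw [List.map_map]; rfl

theorem adjoin_range_symGen : Algebra.adjoin ℚ (Set.range (symGen (n := n))) = ⊤ := by
  have h1 : Algebra.adjoin ℚ (Set.range (SuperSym.ι (VZ.piece n))) = ⊤ := by
    have h2 : Set.range (SuperSym.ι (VZ.piece n)) =
        RingQuot.mkAlgHom ℚ (SuperSymRel (VZ.piece n)) '' Set.range (TensorAlgebra.ι ℚ) := by
      rw [← Set.range_comp]; rfl
    rw [h2, ← AlgHom.map_adjoin, TensorAlgebra.adjoin_range_ι, Algebra.map_top]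
    exact (AlgHom.range_eq_top _).2 (RingQuot.mkAlgHom_surjective ℚ _)
  rw [eq_top_iff, ← h1]
  refine Algebra.adjoin_le ?_
  rintro _ ⟨v, rfl⟩
  rw [SetLike.mem_coe]
  have hv : v ∈ Submodule.span ℚ (Set.range (vzBasis n)) := by
    rw [Module.Basis.span_eq]; trivial
  induction hv using Submodule.span_induction with
  | mem v hv =>
    obtain ⟨p, rfl⟩ := hv
    rw [vzBasis_apply]
    exact Algebra.subset_adjoin ⟨_, rfl⟩
  | zero => rw [map_zero]; exact zero_mem _
  | add a b _ _ ha hb => rw [map_add]; exact add_mem ha hb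
  | smul c a _ ha => rw [map_smul]; exact Subalgebra.smul_mem _ ha c

end Super

end PAlg

end

theorem mainTheorem4 (n : ℕ) :
    (∃ b : Module.Basis (PAlg.PBWIndex n) ℚ (PAlg.P n), ∀ s, b s = PAlg.pbwMonomial s) ∧
    Nonempty (GradedAlgebra (PAlg.P.piece n)) ∧
    Nonempty (GradedAlgebra (PAlg.SuperSym.piece (PAlg.VZ.piece n))) ∧
    ∃ φ : PAlg.P n ≃ₗ[ℚ] PAlg.SuperSym (PAlg.VZ.piece n),
      ∀ γ : PAlg.Bideg n,
        (PAlg.P.piece n γ).map φ.toLinearMap = PAlg.SuperSym.piece (PAlg.VZ.piece n) γ := by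
  have hli := PAlg.linearIndependent_pbwMonomial n
  simp only [funext PAlg.pbwMonomial_eq] at hli
  obtain ⟨b, hb⟩ := PAlg.exists_basis_of_wordSpan_le PAlg.adjoin_range_gen hli PAlg.wordSpan_gen_le
  obtain ⟨c, hc⟩ := PAlg.exists_basis_of_wordSpan_le PAlg.adjoin_range_symGen
    (PAlg.linearIndependent_symGen (n := n)) PAlg.wordSpan_symGen_le
  have hP : PAlg.P.piece n = PAlg.wordSpan PAlg.gen PAlg.Gen.deg := rfl
  rw [hP, PAlg.superSymPiece_eq_wordSpan]
  refine ⟨⟨b, fun s => by rw [hb, PAlg.pbwMonomial_eq]⟩,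
    PAlg.nonempty_gradedAlgebra_wordSpan b hb PAlg.wordSpan_gen_le,
    PAlg.nonempty_gradedAlgebra_wordSpan c hc PAlg.wordSpan_symGen_le,
    b.equiv c (Equiv.refl _), fun γ => ?_⟩
  rw [PAlg.wordSpan_eq_span_basis b hb PAlg.wordSpan_gen_le,
    PAlg.wordSpan_eq_span_basis c hc PAlg.wordSpan_symGen_le, Submodule.map_span,
    ← Set.image_comp]
  congr 1
  refine Set.image_congr fun s _ => ?_
  simp
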